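/- **Theorem (continuity at low regularity).** Let $\mathbb{T}^2=\mathbb{R}^2/\mathbb{Z}^2$. For an integer $k\ge 0$ let $W^{k,2}=W^{k,2}(\mathbb{T}^2)$ be the space of real functions $v\in L^2(\mathbb{T}^2)$ with $$\|v\|_{k,2}^2=\sum_{\xi\in\mathbb{Z}^2}(1+|\xi|^2)^k|\widehat v(\xi)|^2<\infty ,$$ and for vector fields $\|\mathbf{w}\|_{k,2}^2=\sum_j\|w_j\|_{k,2}^2$. Write $\|(b,\omega)\|_{\mathcal{M}}=\|b\|_{3,2}+\|\omega\|_{2,2}$. Let $\mathbf{u}_h\in W^{3,2}(\mathbb{T}^2;\mathbb{R}^2)$ be weakly divergence-free and let $f\in W^{2,2}$. A triple $(b,\omega,T)$ with $T>0$ is a *strong solution* of the thermal quasi-geostrophic (TQG) system with initial data $(b_0,\omega_0)\in W^{3,2}\times W^{2,2}$ if $b\in C([0,T];W^{3,2})$, $\omega\in C([0,T];W^{2,2})$ and, for all $t\in[0,T]$, $$b(t)=b_0-\int_0^t\operatorname{div}(b\mathbf{u})\,d\tau,\qquad \omega(t)=\omega_0-\int_0^t\big[\operatorname{div}((\omega-b)\mathbf{u})+\operatorname{div}(b\mathbf{u}_h)\big]\,d\tau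 ,$$ where at each time $\mathbf{u}=\nabla^\perp\psi=(-\partial_y\psi,\partial_x\psi)$ and $\omega=(\Delta-1)\psi+f$. Let $(b^1,\omega^1,T^1)$ and $(b^2,\omega^2,T^2)$ be strong solutions with the same $\mathbf{u}_h,f$ and with initial data $(b^1_0,\omega^1_0),(b^2_0,\omega^2_0)\in W^{3,2}\times W^{2,2}$, and let $T=\min\{T^1,T^2\}$. Consider the estimate $$\|(b^1-b^2)(t)\|_{2,2}^2+\|(\omega^1-\omega^2)(t)\|_{1,2}^2\le e^{cT}\big(\|b^1_0-b^2_0\|_{2,2}^2+\|\omega^1_0-\omega^2_0\|_{1,2}^2\big)\qquad\text{for all }t\in[0,T].\tag{$*$}$$ 1. There is a constant $\kappa=\kappa(\|\mathbf{u}_h\|_{3,2},\|f\|_{2,2})>0$ such that, whenever $$T<\frac{1}{2\kappa\,(1+\|(b^i_0,\omega^i_0)\|_{\mathcal{M}}^2)}\qquad(i=1,2),$$ $(*)$ holds with a constant $c$ that depends only on $\|b^1_0\|_{3,2}$, $\|\omega^1_0\|_{2,2}$, $\|b^2_0\|_{3,2}$, $\|\omega^2_0\|_{2,2}$, $\|\mathbf{u}_h\|_{3,2}$,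 $\|f\|_{2,2}$. 2. For arbitrary $T^1,T^2>0$, if $B^1,W^1,W^2$ are numbers with $\|b^1(t)\|_{3,2}\le B^1$, $\|\omega^1(t)\|_{2,2}\le W^1$ and $\|\omega^2(t)\|_{2,2}\le W^2$ for all $t\in[0,T]$ (for instance the suprema of these norms over $[0,T]$), then $(*)$ holds with a constant $c$ that depends only on $B^1,W^1,W^2,\|\mathbf{u}_h\|_{3,2},\|f\|_{2,2}$. -/

import Mathlib

open MeasureTheory Filter Topology

noncomputable section

namespace TQG

/-- The two-dimensional flat torus `ℝ² / ℤ²`. Coordinate `0` is `x`, coordinate `1` is `y`. -/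
abbrev Torus : Type := UnitAddTorus (Fin 2)

/-- Normalized Haar (Lebesgue) measure on the torus. -/
abbrev vol : Measure Torus := Measure.pi fun _ => AddCircle.haarAddCircle

/-- Real-valued square-integrable functions on the torus. -/
abbrev L2 : Type := Lp ℝ 2 vol

/-! ### Sobolev spaces `W^{k,2}` on the torus, in frequency space -/

/-- The Fourier coefficient `v̂(ξ)`, `ξ ∈ ℤ²`. -/
def fourierCoeff (v : L2) (ξ : Fin 2 → ℤ) : ℂ :=
  UnitAddTorus.mFourierCoeff (fun x : Torus => ((v x : ℝ) : ℂ)) ξ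

/-- The summand `(1 + |ξ|²)^k |v̂(ξ)|²`. -/
def sobolevTerm (k : ℕ) (v : L2) (ξ : Fin 2 → ℤ) : ℝ :=
  (1 + ∑ i, ((ξ i : ℤ) : ℝ) ^ 2) ^ k * ‖fourierCoeff v ξ‖ ^ 2

/-- `v ∈ W^{k,2}`. -/
def MemSobolev (k : ℕ) (v : L2) : Prop := Summable (sobolevTerm k v)

/-- The norm `‖v‖_{k,2}` (meaningful for `v ∈ W^{k,2}`). -/
def sobolevNorm (k : ℕ) (v : L2) : ℝ := Real.sqrt (∑' ξ, sobolevTerm k v ξ)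

/-- The norm `‖w‖_{k,2}` of a vector field. -/
def sobolevNormVec (k : ℕ) (w : Fin 2 → L2) : ℝ :=
  Real.sqrt (∑ j, sobolevNorm k (w j) ^ 2)

/-- The norm of `W^{3,2} × W^{2,2}`. -/
def strongNorm (b ω : L2) : ℝ := sobolevNorm 3 b + sobolevNorm 2 ω

/-- `v ∈ C([0,T]; W^{k,2})`. -/
def ContinuousInSobolev (k : ℕ) (T : ℝ) (v : ℝ → L2) : Prop :=
  (∀ t ∈ Set.Icc 0 T, MemSobolev k (v t)) ∧
    ∀ t ∈ Set.Icc 0 T,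
      Tendsto (fun s => sobolevNorm k (v s - v t)) (𝓝[Set.Icc 0 T] t) (𝓝 0)

/-! ### Weak derivatives -/

/-- Smooth functions on the torus: those whose periodic lift to `ℝ²` is `C^∞`. -/
def IsTest (φ : Torus → ℝ) : Prop :=
  ContDiff ℝ ((⊤ : ℕ∞) : WithTop ℕ∞) (fun y : Fin 2 → ℝ => φ (fun i => ((y i : ℝ) : UnitAddCircle)))

/-- The classical partial derivative `∂_j φ` of a function on the torus. -/
def partialDeriv (j : Fin 2) (φ : Torus → ℝ) (x : Torus) : ℝ :=
  deriv (fun s : ℝ => φ (x + Pi.single j ((s : ℝ) : UnitAddCircle))) 0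

/-- The classical Laplacian `Δ φ`. -/
def laplacian (φ : Torus → ℝ) (x : Torus) : ℝ :=
  ∑ j, partialDeriv j (partialDeriv j φ) x

/-- `∂_j v = g` weakly. -/
def IsWeakPartial (j : Fin 2) (v g : L2) : Prop :=
  ∀ φ : Torus → ℝ, IsTest φ → ∫ x, v x * partialDeriv j φ x ∂vol = -∫ x, g x * φ x ∂vol

/-- `div F = g` weakly, for an integrable vector field `F`. -/
def IsWeakDiv (F : Torus → Fin 2 → ℝ) (g : L2) : Prop :=
  ∀ φ : Torus → ℝ, IsTest φ → ∫ x, ∑ j, F x j * partialDeriv j φ x ∂vol = -∫ x, g x * φ x ∂vol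

/-- `w ∈ W^{k,2}_div`. -/
def MemSobolevDiv (k : ℕ) (w : Fin 2 → L2) : Prop :=
  (∀ j, MemSobolev k (w j)) ∧ IsWeakDiv (fun x j => w j x) 0

/-! ### The thermal quasi-geostrophic equations -/

/-- `(Δ - 1) ψ + f = ω` weakly. -/
def IsStreamfunction (f ω ψ : L2) : Prop :=
  ∀ φ : Torus → ℝ, IsTest φ →
    ∫ x, ψ x * (laplacian φ x - φ x) ∂vol = ∫ x, (ω x - f x) * φ x ∂vol

/-- `u = ∇^⊥ ψ = (-∂_y ψ, ∂_x ψ)` with `(Δ - 1) ψ + f = ω`. -/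
def IsVelocity (f ω : L2) (u : Fin 2 → L2) : Prop :=
  ∃ ψ : L2, IsStreamfunction f ω ψ ∧
    IsWeakPartial 1 ψ (-(u 0)) ∧ IsWeakPartial 0 ψ (u 1)

/-- `(b, ω, T)` is a local strong solution of the TQG system with data `uh`, `f`, `b₀`, `ω₀`.
The time integrals are Bochner integrals in `L²`. -/
structure IsStrongSolution (uh : Fin 2 → L2) (f b₀ ω₀ : L2) (b ω : ℝ → L2) (T : ℝ) : Prop where
  pos : 0 < T
  continuous_b : ContinuousInSobolev 3 T b
  continuous_ω : ContinuousInSobolev 2 T ω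
  equations : ∃ (u : ℝ → Fin 2 → L2) (Db Dω : ℝ → L2),
    (∀ t ∈ Set.Icc 0 T,
      IsVelocity f (ω t) (u t) ∧
      IsWeakDiv (fun x j => b t x * u t j x) (Db t) ∧
      IsWeakDiv (fun x j => (ω t x - b t x) * u t j x + b t x * uh j x) (Dω t)) ∧
    IntervalIntegrable Db volume 0 T ∧
    IntervalIntegrable Dω volume 0 T ∧
    ∀ t ∈ Set.Icc 0 T,
      b t = b₀ - ∫ τ in (0 : ℝ)..t, Db τ ∧
      ω t = ω₀ - ∫ τ in (0 : ℝ)..t, Dω τ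

end TQG

end

noncomputable section

namespace TQG

open scoped ENNReal NNReal ComplexConjugate
open UnitAddTorus

/-! ### Weighted square-summable sequences on the frequency lattice -/

/-! All estimates are made on Fourier coefficients: `W^{k,2}` becomes a weighted `ℓ²` space with
weight `⟨ξ⟩^k`, and for solenoidal `u` the map `q ↦ div (q u)` becomes a matrix with kernel `2πi
η·û(ξ-η)`. Since `u` is real and divergence free, this kernel is skew-Hermitian. In an energy
pairing with weight `w`, only the commutator with the factor `w(ξ) - w(η)` therefore survives
(`enorm_re_tsum_weight_le`). As `⟨·⟩` is 1-Lipschitz, the commutator moves a derivative onto `u`.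
Young's inequality `ℓ¹ * ℓ² ⊂ ℓ²` and the absolute convergence of Fourier series in `W^{2,2}` then
bound it by the order-3 norm of `u` (`IsWeight.transport_le`), which `ω` and `f` control at order 2
(`IsVelocity.sob_modulus_le`).

For two solutions put `β = b¹ - b²`, `ϖ = ω¹ - ω²`, `v = u¹ - u²`. Then `∂ₜβ + div(β u²) = -div(b¹
v)` and `∂ₜϖ + div(ϖ u²) = -div((ω¹ - b¹) v) - div(β u_h) + div(β u²)`. The energy is taken in
`W^{2,2} × W^{1,2}`, one order below the solutions, so `b¹` and `ω¹` can afford the derivative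
falling on them, while `v` is one order smoother than `ϖ`. Only norms of `b¹`, `ω¹`, `ω²` enter, and
Grönwall gives the second claim (`difference_estimate`).

For the first claim these norms are bounded by the data: `y = 1 + ‖b‖²_{3,2} + ‖ω‖²_{2,2}` satisfies
`y ≤ y₀ + C ∫ y²`, hence stays below `2 y₀` on a short interval (`apriori_bound`). At top order the
pairing need not converge absolutely, so the last factor of the weight is truncated to `min ⟨ξ⟩ N`;
the commutator bounds are uniform in `N`.

The equations hold only in integrated form, so the energy balance is derived for each frequency and
summed by dominated convergence (`sqSum_le_add_integral`). -/

/-- The lattice of frequencies. -/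
abbrev Freq : Type := Fin 2 → ℤ

/-- The squared `ℓ²` norm of a nonnegative sequence. -/
def sqSum {ι : Type*} (f : ι → ℝ≥0∞) : ℝ≥0∞ := ∑' i, f i ^ 2

theorem sqSum_mono {ι : Type*} {f g : ι → ℝ≥0∞} (h : ∀ i, f i ≤ g i) : sqSum f ≤ sqSum g :=
  ENNReal.tsum_le_tsum fun i => pow_le_pow_left' (h i) 2

theorem sqSum_const_mul {ι : Type*} (c : ℝ≥0∞) (f : ι → ℝ≥0∞) :
    sqSum (fun i => c * f i) = c ^ 2 * sqSum f := by
  simp only [sqSum, mul_pow, ENNReal.tsum_mul_left]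

theorem add_sq_le_two_mul (a b : ℝ≥0∞) : (a + b) ^ 2 ≤ 2 * (a ^ 2 + b ^ 2) := by
  induction a with
  | top => simp
  | coe a =>
    induction b with
    | top => simp
    | coe b => exact_mod_cast (add_sq_le (a := a) (b := b))

theorem two_mul_mul_le_sq_add_sq (a b : ℝ≥0∞) : 2 * (a * b) ≤ a ^ 2 + b ^ 2 := by
  rcases le_total a b with h | h
  · obtain ⟨c, rfl⟩ := exists_add_of_le h
    calc 2 * (a * (a + c)) ≤ 2 * (a * (a + c)) + c ^ 2 := le_self_add
      _ = a ^ 2 + (a + c) ^ 2 := by ring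
  · obtain ⟨c, rfl⟩ := exists_add_of_le h
    calc 2 * ((b + c) * b) ≤ 2 * ((b + c) * b) + c ^ 2 := le_self_add
      _ = (b + c) ^ 2 + b ^ 2 := by ring

theorem sqSum_add_le {ι : Type*} (f g : ι → ℝ≥0∞) :
    sqSum (fun i => f i + g i) ≤ 2 * (sqSum f + sqSum g) := by
  simp only [sqSum]
  rw [← ENNReal.tsum_add, ← ENNReal.tsum_mul_left]
  exact ENNReal.tsum_le_tsum fun i => add_sq_le_two_mul _ _

/-- The Cauchy-Schwarz inequality for sums of extended nonnegative reals. -/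
theorem tsum_mul_sq_le {ι : Type*} (f g : ι → ℝ≥0∞) :
    (∑' i, f i * g i) ^ 2 ≤ sqSum f * sqSum g := by
  let _ : MeasurableSpace ι := ⊤
  have h := ENNReal.lintegral_mul_le_Lp_mul_Lq (Measure.count : Measure ι)
    Real.HolderConjugate.two_two (f := f) (g := g) measurable_from_top.aemeasurable
    measurable_from_top.aemeasurable
  simp only [lintegral_count, Pi.mul_apply, ENNReal.rpow_two] at h
  calc (∑' i, f i * g i) ^ 2 ≤ _ := pow_le_pow_left' h 2
    _ = sqSum f * sqSum g := by
      rw [mul_pow, ← ENNReal.rpow_two, ← ENNReal.rpow_two, ← ENNReal.rpow_mul, ← ENNReal.rpow_mul]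
      norm_num [sqSum]

/-- Convolution of nonnegative sequences. -/
def conv (f g : Freq → ℝ≥0∞) (ξ : Freq) : ℝ≥0∞ := ∑' η, f (ξ - η) * g η

theorem conv_comm (f g : Freq → ℝ≥0∞) (ξ : Freq) : conv f g ξ = conv g f ξ := by
  unfold conv
  rw [← (Equiv.subLeft ξ).tsum_eq]
  simp [Equiv.subLeft, mul_comm]

/-- Young's inequality `ℓ¹ * ℓ² ⊂ ℓ²`: split `f = f^{1/2} f^{1/2}`, apply Cauchy-Schwarz in `η`,
then sum over `ξ` by Tonelli. -/
theorem sqSum_conv_le (f g : Freq → ℝ≥0∞) :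
    sqSum (conv f g) ≤ (∑' ξ, f ξ) ^ 2 * sqSum g := by
  have h1 : ∀ ξ, conv f g ξ ^ 2 ≤ (∑' ζ, f ζ) * ∑' η, f (ξ - η) * g η ^ 2 := by
    intro ξ
    have h := tsum_mul_sq_le (fun η => f (ξ - η) ^ (1 / 2 : ℝ))
      (fun η => f (ξ - η) ^ (1 / 2 : ℝ) * g η)
    have h2 : ∀ x : ℝ≥0∞, x ^ (1 / 2 : ℝ) * x ^ (1 / 2 : ℝ) = x := fun x => by
      rw [← ENNReal.rpow_add_of_nonneg _ _ (by norm_num) (by norm_num)]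
      norm_num
    simp only [sqSum, sq, ← mul_assoc, h2] at h
    have h3 : ∑' η, f (ξ - η) = ∑' ζ, f ζ := (Equiv.subLeft ξ).tsum_eq f
    have h4 : ∀ η, f (ξ - η) ^ (1 / 2 : ℝ) * g η * f (ξ - η) ^ (1 / 2 : ℝ) * g η
        = f (ξ - η) * g η ^ 2 := fun η => by
      rw [mul_right_comm _ (g η), h2, sq, mul_assoc]
    simp only [h3, h4] at h
    rw [sq]
    exact h
  calc sqSum (conv f g) ≤ ∑' ξ, (∑' ζ, f ζ) * ∑' η, f (ξ - η) * g η ^ 2 :=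
        ENNReal.tsum_le_tsum h1
    _ = (∑' ζ, f ζ) * ∑' η, ∑' ξ, f (ξ - η) * g η ^ 2 := by
        rw [ENNReal.tsum_mul_left, ENNReal.tsum_comm]
    _ = (∑' ζ, f ζ) * ∑' η, (∑' ζ, f ζ) * g η ^ 2 := by
        congr 1
        refine tsum_congr fun η => ?_
        rw [ENNReal.tsum_mul_right]
        congr 1
        exact (Equiv.subRight η).tsum_eq f
    _ = _ := by rw [ENNReal.tsum_mul_left, sqSum]; ring

theorem sqSum_conv_le' (f g : Freq → ℝ≥0∞) :
    sqSum (conv f g) ≤ sqSum f * (∑' ξ, g ξ) ^ 2 := by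
  have : conv f g = conv g f := funext (conv_comm f g)
  rw [this, mul_comm]
  exact sqSum_conv_le g f

/-! ### The weight `⟨ξ⟩ = (1 + |ξ|²)^{1/2}` -/

/-- The weight `(1 + |ξ|²)^{1/2}`. -/
def lam (ξ : Freq) : ℝ := Real.sqrt (1 + ∑ i, (ξ i : ℝ) ^ 2)

theorem lam_sq (ξ : Freq) : lam ξ ^ 2 = 1 + ∑ i, (ξ i : ℝ) ^ 2 :=
  Real.sq_sqrt (by positivity)

theorem one_le_lam (ξ : Freq) : 1 ≤ lam ξ :=
  Real.one_le_sqrt.2 (le_add_of_nonneg_right (by positivity))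

theorem lam_pos (ξ : Freq) : 0 < lam ξ := one_pos.trans_le (one_le_lam ξ)

theorem abs_coord_le_lam (ξ : Freq) (j : Fin 2) : |(ξ j : ℝ)| ≤ lam ξ := by
  refine abs_le_of_sq_le_sq ?_ (lam_pos ξ).le
  rw [lam_sq]
  have := Finset.single_le_sum (f := fun i => (ξ i : ℝ) ^ 2) (fun i _ => sq_nonneg _)
    (Finset.mem_univ j)
  linarith

/-- `⟨ξ⟩` is the Euclidean norm of `(1, ξ)`, so this is the reverse triangle inequality with room to
spare; `hxy` below is Cauchy-Schwarz for `(1, ξ)` and `(1, η)`. -/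
theorem abs_lam_sub_le (ξ η : Freq) : |lam ξ - lam η| ≤ lam (ξ - η) := by
  refine abs_le_of_sq_le_sq ?_ (lam_pos _).le
  have hx := lam_sq ξ
  have hy := lam_sq η
  rw [lam_sq]
  simp only [Fin.sum_univ_two, Pi.sub_apply, Int.cast_sub] at *
  have hxy : 1 + (ξ 0 : ℝ) * η 0 + ξ 1 * η 1 ≤ lam ξ * lam η := by
    refine le_of_sq_le_sq ?_ (mul_pos (lam_pos _) (lam_pos _)).le
    rw [mul_pow, hx, hy]
    nlinarith [sq_nonneg ((ξ 0 : ℝ) - η 0), sq_nonneg ((ξ 1 : ℝ) - η 1),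
      sq_nonneg ((ξ 0 : ℝ) * η 1 - ξ 1 * η 0)]
  nlinarith

theorem lam_le_add (ξ η : Freq) : lam ξ ≤ lam (ξ - η) + lam η := by
  linarith [le_abs_self (lam ξ - lam η), abs_lam_sub_le ξ η]

/-- The weight `⟨ξ⟩` as an extended nonnegative real. -/
def elam (ξ : Freq) : ℝ≥0∞ := ENNReal.ofReal (lam ξ)

theorem one_le_elam (ξ : Freq) : 1 ≤ elam ξ := by
  rw [elam, ENNReal.one_le_ofReal]
  exact one_le_lam ξ

theorem elam_ne_top (ξ : Freq) : elam ξ ≠ ⊤ := ENNReal.ofReal_ne_top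

theorem elam_ne_zero (ξ : Freq) : elam ξ ≠ 0 := (one_pos.trans_le (one_le_elam ξ)).ne'

theorem elam_le_add (ξ η : Freq) : elam ξ ≤ elam (ξ - η) + elam η := by
  rw [elam, elam, elam, ← ENNReal.ofReal_add (lam_pos _).le (lam_pos _).le]
  exact ENNReal.ofReal_le_ofReal (lam_le_add ξ η)

/-- The constant of the embedding of `W^{2,2}` into absolutely convergent Fourier series. -/
def embConst : ℝ≥0∞ := sqSum fun ξ => (elam ξ ^ 2)⁻¹

theorem embConst_ne_top : embConst ≠ ⊤ := by
  have hs : Summable fun n : ℤ => (1 + (n : ℝ) ^ 2)⁻¹ := by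
    refine Summable.of_norm_bounded_eventually (g := fun n : ℤ => 1 / (n : ℝ) ^ 2)
      (Real.summable_one_div_int_pow.2 one_lt_two) ?_
    filter_upwards [(Set.finite_singleton (0 : ℤ)).compl_mem_cofinite] with n hn
    have hn' : (n : ℝ) ≠ 0 := Int.cast_ne_zero.2 hn
    rw [Real.norm_of_nonneg (by positivity), one_div]
    exact inv_anti₀ (by positivity) (by linarith)
  have h1 : ∑' n : ℤ, ENNReal.ofReal ((1 + (n : ℝ) ^ 2)⁻¹) ≠ ⊤ := hs.tsum_ofReal_ne_top
  -- `(1 + m²)(1 + n²) ≤ (1 + m² + n²)²` reduces the lattice sum to a product of two one-dimensional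
  -- sums.
  have h2 : embConst ≤ (∑' n : ℤ, ENNReal.ofReal ((1 + (n : ℝ) ^ 2)⁻¹)) ^ 2 := by
    calc embConst ≤ ∑' ξ : Freq, ENNReal.ofReal ((1 + (ξ 0 : ℝ) ^ 2)⁻¹) *
          ENNReal.ofReal ((1 + (ξ 1 : ℝ) ^ 2)⁻¹) := by
          refine ENNReal.tsum_le_tsum fun ξ => ?_
          simp only [elam]
          rw [← ENNReal.ofReal_pow (lam_pos _).le,
            ← ENNReal.ofReal_inv_of_pos (pow_pos (lam_pos _) _),
            ← ENNReal.ofReal_pow (by have := lam_pos ξ; positivity),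
            ← ENNReal.ofReal_mul (by positivity), lam_sq, ← mul_inv, inv_pow]
          refine ENNReal.ofReal_le_ofReal (inv_anti₀ (by positivity) ?_)
          rw [Fin.sum_univ_two]
          nlinarith [sq_nonneg (ξ 0 : ℝ), sq_nonneg (ξ 1 : ℝ),
            mul_nonneg (sq_nonneg (ξ 0 : ℝ)) (sq_nonneg (ξ 1 : ℝ)),
            sq_nonneg ((ξ 0 : ℝ) ^ 2), sq_nonneg ((ξ 1 : ℝ) ^ 2)]
      _ = ∑' p : ℤ × ℤ, ENNReal.ofReal ((1 + (p.1 : ℝ) ^ 2)⁻¹) *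
          ENNReal.ofReal ((1 + (p.2 : ℝ) ^ 2)⁻¹) := by
          rw [← (finTwoArrowEquiv ℤ).tsum_eq]
          rfl
      _ = _ := by
          rw [ENNReal.tsum_prod (f := fun m n : ℤ => ENNReal.ofReal ((1 + (m : ℝ) ^ 2)⁻¹) *
            ENNReal.ofReal ((1 + (n : ℝ) ^ 2)⁻¹))]
          simp only [ENNReal.tsum_mul_left, ENNReal.tsum_mul_right, sq]
  exact ne_top_of_le_ne_top (ENNReal.pow_ne_top h1) h2

/-- The squared norm of order `k` of a sequence of moduli. -/
def sob (k : ℕ) (f : Freq → ℝ≥0∞) : ℝ≥0∞ := sqSum fun ξ => elam ξ ^ k * f ξ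

theorem sob_mono {k l : ℕ} (h : k ≤ l) (f : Freq → ℝ≥0∞) : sob k f ≤ sob l f :=
  sqSum_mono fun ξ => mul_le_mul_left (pow_le_pow_right₀ (one_le_elam ξ) h) _

/-- Sobolev embedding into absolutely convergent Fourier series: Cauchy-Schwarz against `⟨ξ⟩⁻²`,
which is square summable in dimension two. -/
theorem tsum_sq_le_sob (f : Freq → ℝ≥0∞) : (∑' ξ, f ξ) ^ 2 ≤ embConst * sob 2 f := by
  have h := tsum_mul_sq_le (fun ξ => (elam ξ ^ 2)⁻¹) fun ξ => elam ξ ^ 2 * f ξ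
  have h2 : ∀ ξ, (elam ξ ^ 2)⁻¹ * (elam ξ ^ 2 * f ξ) = f ξ := fun ξ => by
    rw [← mul_assoc, ENNReal.inv_mul_cancel (pow_ne_zero _ (elam_ne_zero ξ))
      (ENNReal.pow_ne_top (elam_ne_top ξ)), one_mul]
  simp only [h2] at h
  exact h

theorem tsum_elam_pow_mul_sq_le (k : ℕ) (f : Freq → ℝ≥0∞) :
    (∑' ξ, elam ξ ^ k * f ξ) ^ 2 ≤ embConst * sob (k + 2) f := by
  refine (tsum_sq_le_sob _).trans_eq ?_
  simp only [sob, ← mul_assoc, ← pow_add, add_comm]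

/-- A substitute for the Leibniz rule, with `x = ⟨ξ⟩`, `d = ⟨ξ-η⟩`, `y = ⟨η⟩`. Mixed terms are
absorbed so that either the first factor carries two derivatives or the second carries `k + 2`; in
both cases the remaining factor can be taken in `ℓ¹`. -/
theorem pow_mul_le_of_le_add {x d y : ℝ≥0∞} (h : x ≤ d + y) {k : ℕ} (hk : k ≤ 1) :
    x ^ (k + 1) * y ≤ 2 * (d ^ 2 * y ^ k + y ^ (k + 2)) := by
  interval_cases k
  · calc x ^ (0 + 1) * y ≤ (d + y) ^ (0 + 1) * y := by gcongr
      _ ≤ 2 * (d * y) + y ^ 2 := by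
        rw [zero_add, pow_one, add_mul, two_mul, sq]
        gcongr
        exact le_self_add
      _ ≤ d ^ 2 + y ^ 2 + y ^ 2 := by gcongr; exact two_mul_mul_le_sq_add_sq d y
      _ ≤ d ^ 2 + (d ^ 2 + y ^ 2 + y ^ 2) := le_add_self
      _ = _ := by ring
  · calc x ^ (1 + 1) * y ≤ (d + y) ^ 2 * y := by gcongr
      _ ≤ 2 * (d ^ 2 + y ^ 2) * y := by gcongr; exact add_sq_le_two_mul d y
      _ = _ := by ring

/-- The product estimate for `v · ∇q` in `W^{k+1,2}`, `k ≤ 1`, in terms of moduli. -/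
theorem sob_conv_le {k : ℕ} (hk : k ≤ 1) (U q : Freq → ℝ≥0∞) :
    sob (k + 1) (conv U fun η => elam η * q η) ≤
      16 * embConst * sob 2 U * sob (k + 2) q := by
  have h1 : ∀ ξ, elam ξ ^ (k + 1) * conv U (fun η => elam η * q η) ξ ≤
      2 * (conv (fun ζ => elam ζ ^ 2 * U ζ) (fun η => elam η ^ k * q η) ξ +
        conv U (fun η => elam η ^ (k + 2) * q η) ξ) := by
    intro ξ
    simp only [conv]
    rw [← ENNReal.tsum_add, ← ENNReal.tsum_mul_left, ← ENNReal.tsum_mul_left]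
    refine ENNReal.tsum_le_tsum fun η => ?_
    calc elam ξ ^ (k + 1) * (U (ξ - η) * (elam η * q η))
        = elam ξ ^ (k + 1) * elam η * (U (ξ - η) * q η) := by ring
      _ ≤ 2 * (elam (ξ - η) ^ 2 * elam η ^ k + elam η ^ (k + 2)) * (U (ξ - η) * q η) :=
        mul_le_mul_left (pow_mul_le_of_le_add (elam_le_add ξ η) hk) _
      _ = _ := by ring
  calc sob (k + 1) (conv U fun η => elam η * q η)
      ≤ 2 ^ 2 * (2 * (sqSum (conv (fun ζ => elam ζ ^ 2 * U ζ) (fun η => elam η ^ k * q η)) +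
        sqSum (conv U (fun η => elam η ^ (k + 2) * q η)))) := by
        refine (sqSum_mono h1).trans ?_
        rw [sqSum_const_mul]
        gcongr
        exact sqSum_add_le _ _
    _ ≤ 2 ^ 2 * (2 * (sob 2 U * (embConst * sob (k + 2) q) +
        (embConst * sob 2 U) * sob (k + 2) q)) := by
        gcongr
        · refine (sqSum_conv_le' _ _).trans ?_
          gcongr
          · exact le_rfl
          · exact tsum_elam_pow_mul_sq_le k q
        · refine (sqSum_conv_le _ _).trans ?_
          gcongr
          · exact tsum_sq_le_sob U
          · exact le_rfl
    _ = _ := by ring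

/-- The commutator estimate in terms of moduli. -/
theorem sqSum_commutator_le {k : ℕ} {C : ℝ≥0∞} {θ : Freq → Freq → ℝ≥0∞} {μ : Freq → ℝ≥0∞}
    (hθ : ∀ ξ η, θ ξ η ≤ C * (elam (ξ - η) * elam η ^ k + elam (ξ - η) ^ 3 * μ η))
    (hμ : ∀ η, elam η ^ 2 * μ η ≤ elam η ^ k) (U a : Freq → ℝ≥0∞) :
    sqSum (fun ξ => ∑' η, θ ξ η * (U (ξ - η) * a η)) ≤
      4 * C ^ 2 * embConst * sob 3 U * sob k a := by
  have h1 : ∀ ξ, ∑' η, θ ξ η * (U (ξ - η) * a η) ≤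
      C * (conv (fun ζ => elam ζ * U ζ) (fun η => elam η ^ k * a η) ξ +
        conv (fun ζ => elam ζ ^ 3 * U ζ) (fun η => μ η * a η) ξ) := by
    intro ξ
    simp only [conv]
    rw [← ENNReal.tsum_add, ← ENNReal.tsum_mul_left]
    refine ENNReal.tsum_le_tsum fun η => ?_
    calc θ ξ η * (U (ξ - η) * a η)
        ≤ C * (elam (ξ - η) * elam η ^ k + elam (ξ - η) ^ 3 * μ η) * (U (ξ - η) * a η) := by
          gcongr
          exact hθ ξ η
      _ = _ := by ring
  -- The first piece uses `⟨·⟩U` as its `ℓ¹` factor, which costs order 3. The second puts all three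
  -- derivatives of `U` in `ℓ²`, so `μ a` must be the `ℓ¹` factor; `hμ` is what allows this.
  have h2 : (∑' ζ, elam ζ * U ζ) ^ 2 ≤ embConst * sob 3 U := by
    simpa using tsum_elam_pow_mul_sq_le 1 U
  have h3 : (∑' η, μ η * a η) ^ 2 ≤ embConst * sob k a := by
    refine (tsum_sq_le_sob _).trans ?_
    gcongr
    refine sqSum_mono fun ξ => ?_
    rw [← mul_assoc]
    gcongr
    exact hμ ξ
  calc sqSum (fun ξ => ∑' η, θ ξ η * (U (ξ - η) * a η))
      ≤ C ^ 2 * (2 * (sqSum (conv (fun ζ => elam ζ * U ζ) (fun η => elam η ^ k * a η)) +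
        sqSum (conv (fun ζ => elam ζ ^ 3 * U ζ) (fun η => μ η * a η)))) := by
        refine (sqSum_mono h1).trans ?_
        rw [sqSum_const_mul]
        gcongr
        exact sqSum_add_le _ _
    _ ≤ C ^ 2 * (2 * ((embConst * sob 3 U) * sob k a + sob 3 U * (embConst * sob k a))) := by
        gcongr
        · refine (sqSum_conv_le _ _).trans ?_
          gcongr
          exact le_rfl
        · refine (sqSum_conv_le' _ _).trans ?_
          gcongr
          exact le_rfl
    _ = _ := by ring

/-! ### The transport operator `u · ∇` in frequency space -/

/-- The kernel of the operator `u · ∇`, where `u` is given by its Fourier coefficients. -/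
def transportKernel (u : Fin 2 → Freq → ℂ) (ξ η : Freq) : ℂ :=
  2 * Real.pi * Complex.I * ∑ j, (η j : ℂ) * u j (ξ - η)

theorem enorm_complex_ofReal (x : ℝ) : ‖(x : ℂ)‖ₑ = ‖x‖ₑ := by
  rw [← ofReal_norm, ← ofReal_norm, Complex.norm_real]

/-- The modulus sequence of a vector-valued sequence. -/
def modulus (u : Fin 2 → Freq → ℂ) (ξ : Freq) : ℝ≥0∞ := ∑ j, ‖u j ξ‖ₑ

/-- Sequences of Fourier coefficients of real divergence-free vector fields. -/
structure IsSolenoidal (u : Fin 2 → Freq → ℂ) : Prop where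
  conj_symm : ∀ j ξ, u j (-ξ) = conj (u j ξ)
  div_free : ∀ ξ, ∑ j, (ξ j : ℂ) * u j ξ = 0

/-- Skew-adjointness of `u · ∇`: reality of `u` gives the conjugate, and `(ξ-η)·û(ξ-η) = 0`
exchanges `ξ` for `η` in the symbol. -/
theorem IsSolenoidal.transportKernel_swap {u : Fin 2 → Freq → ℂ} (hu : IsSolenoidal u)
    (ξ η : Freq) : transportKernel u η ξ = -conj (transportKernel u ξ η) := by
  have h1 := hu.div_free (ξ - η)
  have h2 : ∀ j, u j (η - ξ) = conj (u j (ξ - η)) := fun j => by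
    rw [← hu.conj_symm, neg_sub]
  have h3 := congrArg conj h1
  simp only [transportKernel, Fin.sum_univ_two, h2, map_mul, map_add, map_zero, Complex.conj_I,
    Complex.conj_ofReal, map_ofNat, map_intCast, map_sub, Pi.sub_apply, Int.cast_sub] at h3 ⊢
  linear_combination (2 * Real.pi * Complex.I) * h3

theorem enorm_transportKernel_le (u : Fin 2 → Freq → ℂ) (ξ η : Freq) :
    ‖transportKernel u ξ η‖ₑ ≤ 7 * (elam η * modulus u (ξ - η)) := by
  -- The constant 7 is a round upper bound for `2π`.
  have h1 : ‖(2 * Real.pi * Complex.I : ℂ)‖ₑ ≤ 7 := by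
    rw [← ofReal_norm, ← ENNReal.ofReal_ofNat 7]
    refine ENNReal.ofReal_le_ofReal ?_
    simp only [Complex.norm_mul, Complex.norm_ofNat, Complex.norm_real, Complex.norm_I, mul_one]
    rw [Real.norm_of_nonneg Real.pi_pos.le]
    linarith [Real.pi_lt_d2]
  rw [transportKernel, enorm_mul, modulus, Finset.mul_sum]
  gcongr
  refine (enorm_sum_le _ _).trans ?_
  gcongr with j _
  rw [enorm_mul]
  gcongr
  rw [← ofReal_norm, elam, Complex.norm_intCast]
  exact ENNReal.ofReal_le_ofReal (abs_coord_le_lam η j)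

/-- The modulus of `u · ∇ q` is bounded by a convolution. -/
theorem enorm_le_conv_of_hasSum {u : Fin 2 → Freq → ℂ} {q D : Freq → ℂ} {ξ : Freq}
    (h : HasSum (fun η => transportKernel u ξ η * q η) (D ξ)) :
    ‖D ξ‖ₑ ≤ 7 * conv (modulus u) (fun η => elam η * ‖q η‖ₑ) ξ := by
  rw [← h.tsum_eq]
  refine (enorm_tsum_le_tsum_enorm).trans ?_
  rw [conv, ← ENNReal.tsum_mul_left]
  refine ENNReal.tsum_le_tsum fun η => ?_
  rw [enorm_mul]
  calc _ ≤ 7 * (elam η * modulus u (ξ - η)) * ‖q η‖ₑ := by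
        gcongr
        exact enorm_transportKernel_le u ξ η
    _ = _ := by ring

/-- The product estimate for `u · ∇ q` in `W^{k+1,2}`, `k ≤ 1`. -/
theorem sob_transport_le {k : ℕ} (hk : k ≤ 1) {u : Fin 2 → Freq → ℂ} {q D : Freq → ℂ}
    (h : ∀ ξ, HasSum (fun η => transportKernel u ξ η * q η) (D ξ)) :
    sob (k + 1) (fun ξ => ‖D ξ‖ₑ) ≤
      784 * embConst * sob 2 (modulus u) * sob (k + 2) (fun ξ => ‖q ξ‖ₑ) := by
  calc sob (k + 1) (fun ξ => ‖D ξ‖ₑ)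
      ≤ sqSum (fun ξ => 7 * (elam ξ ^ (k + 1) *
          conv (modulus u) (fun η => elam η * ‖q η‖ₑ) ξ)) := by
        refine sqSum_mono fun ξ => ?_
        rw [mul_left_comm]
        gcongr
        exact enorm_le_conv_of_hasSum (h ξ)
    _ = 7 ^ 2 * sob (k + 1) (conv (modulus u) (fun η => elam η * ‖q η‖ₑ)) := sqSum_const_mul _ _
    _ ≤ 7 ^ 2 * (16 * embConst * sob 2 (modulus u) * sob (k + 2) (fun ξ => ‖q ξ‖ₑ)) := by
        gcongr
        exact sob_conv_le hk _ _
    _ = _ := by ring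

/-! ### Weighted energy estimates for the skew-Hermitian kernel -/

theorem tsum_mul_ne_top {ι : Type*} {f g : ι → ℝ≥0∞} (hf : sqSum f ≠ ⊤) (hg : sqSum g ≠ ⊤) :
    ∑' i, f i * g i ≠ ⊤ := fun h => by
  have := tsum_mul_sq_le f g
  rw [h, ENNReal.top_pow two_ne_zero, top_le_iff] at this
  exact ENNReal.mul_ne_top hf hg this

theorem summable_of_tsum_enorm_ne_top {ι : Type*} {f : ι → ℂ} (h : ∑' i, ‖f i‖ₑ ≠ ⊤) :
    Summable f := by
  refine Summable.of_norm ?_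
  have := ENNReal.summable_toReal h
  simpa using this

/-- A skew-Hermitian bilinear form has vanishing real part on the diagonal; with weights only the
commutator of the weight with the form remains. -/
theorem enorm_re_tsum_weight_le {K : Freq → Freq → ℂ} (hK : ∀ ξ η, K η ξ = -conj (K ξ η))
    {a D : Freq → ℂ} (hD : ∀ ξ, HasSum (fun η => K ξ η * a η) (D ξ)) (w : Freq → ℝ)
    (h₁ : ∑' p : Freq × Freq, ‖(w p.1 : ℂ) ^ 2 * (conj (a p.1) * (K p.1 p.2 * a p.2))‖ₑ ≠ ⊤)
    (h₂ : ∑' p : Freq × Freq,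
      ‖(w p.1 : ℂ) * w p.2 * (conj (a p.1) * (K p.1 p.2 * a p.2))‖ₑ ≠ ⊤) :
    2 * ‖(∑' ξ, (w ξ : ℂ) ^ 2 * (conj (a ξ) * D ξ)).re‖ₑ ≤
      sqSum (fun ξ => ‖w ξ‖ₑ * ‖a ξ‖ₑ) +
        sqSum (fun ξ => ∑' η, ‖w ξ - w η‖ₑ * (‖K ξ η‖ₑ * ‖a η‖ₑ)) := by
  set f : Freq × Freq → ℂ := fun p => (w p.1 : ℂ) ^ 2 * (conj (a p.1) * (K p.1 p.2 * a p.2)) with hf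
  set g : Freq × Freq → ℂ := fun p => (w p.1 : ℂ) * w p.2 * (conj (a p.1) * (K p.1 p.2 * a p.2))
    with hg
  have sf : Summable f := summable_of_tsum_enorm_ne_top h₁
  have sg : Summable g := summable_of_tsum_enorm_ne_top h₂
  have e1 : ∑' ξ, (w ξ : ℂ) ^ 2 * (conj (a ξ) * D ξ) = ∑' p, f p := by
    rw [sf.tsum_prod]
    refine tsum_congr fun ξ => ?_
    exact (((hD ξ).mul_left _).mul_left _).tsum_eq.symm
  -- The symmetric weight `w(ξ) w(η)` preserves skewness: exchanging `ξ` and `η` turns the sum into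
  -- minus its conjugate. It is purely imaginary, and subtracting it leaves the commutator.
  have e2 : (∑' p, g p).re = 0 := by
    have h : ∑' p, g p = -conj (∑' p, g p) := by
      conv_lhs => rw [← (Equiv.prodComm Freq Freq).tsum_eq]
      rw [Complex.conj_tsum, ← tsum_neg]
      refine tsum_congr fun p => ?_
      simp only [hg, Equiv.prodComm_apply, Prod.fst_swap, Prod.snd_swap, map_mul,
        Complex.conj_ofReal, Complex.conj_conj, hK p.1 p.2]
      ring
    have := congrArg Complex.re h
    simp only [Complex.neg_re, Complex.conj_re] at this
    linarith
  have e3 : (∑' p, f p).re = (∑' p, (f p - g p)).re := by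
    rw [sf.tsum_sub sg, Complex.sub_re, e2, sub_zero]
  have e4 : ‖(∑' p, f p).re‖ₑ ≤ ∑' p, ‖f p - g p‖ₑ := by
    rw [e3]
    refine le_trans ?_ (enorm_tsum_le_tsum_enorm)
    rw [← ofReal_norm, ← ofReal_norm]
    exact ENNReal.ofReal_le_ofReal (Complex.abs_re_le_norm _)
  have e5 : ∑' p, ‖f p - g p‖ₑ = ∑' ξ, (‖w ξ‖ₑ * ‖a ξ‖ₑ) *
      ∑' η, ‖w ξ - w η‖ₑ * (‖K ξ η‖ₑ * ‖a η‖ₑ) := by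
    rw [ENNReal.tsum_prod']
    refine tsum_congr fun ξ => ?_
    rw [← ENNReal.tsum_mul_left]
    refine tsum_congr fun η => ?_
    have : f (ξ, η) - g (ξ, η) =
        (w ξ : ℂ) * conj (a ξ) * (((w ξ - w η : ℝ) : ℂ) * (K ξ η * a η)) := by
      simp only [hf, hg]
      push_cast
      ring
    rw [this]
    simp only [enorm_mul, RCLike.enorm_conj, enorm_complex_ofReal]
  rw [e1]
  calc 2 * ‖(∑' p, f p).re‖ₑ ≤ 2 * ∑' ξ, (‖w ξ‖ₑ * ‖a ξ‖ₑ) *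
      ∑' η, ‖w ξ - w η‖ₑ * (‖K ξ η‖ₑ * ‖a η‖ₑ) := by
        rw [← e5]
        gcongr
    _ ≤ _ := by
        rw [← ENNReal.tsum_mul_left, sqSum, sqSum, ← ENNReal.tsum_add]
        exact ENNReal.tsum_le_tsum fun ξ => two_mul_mul_le_sq_add_sq _ _

/-- An admissible weight of order `l`, dominated by a multiple of `⟨ξ⟩^{k+1}`. -/
structure IsWeight (k l : ℕ) (w : Freq → ℝ) : Prop where
  -- Qualitative: it makes the double sums converge absolutely for `a` of order `k + 2`. Since `N`
  -- does not enter the energy bound, it may depend on a truncation.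
  bound : ∃ N : ℝ≥0∞, N ≠ ⊤ ∧ ∀ ξ, ‖w ξ‖ₑ ≤ N * elam ξ ^ (k + 1)
  le : ∀ ξ, ‖w ξ‖ₑ ≤ elam ξ ^ l
  -- Quantitative: the constant 10 serves every weight, uniformly in the truncation. Plain weights
  -- have `l = k + 1`, truncated ones `l = k + 2`.
  commutator : ∃ μ : Freq → ℝ≥0∞, (∀ η, elam η ^ 2 * μ η ≤ elam η ^ l) ∧
    ∀ ξ η, ‖w ξ - w η‖ₑ * elam η ≤
      10 * (elam (ξ - η) * elam η ^ l + elam (ξ - η) ^ 3 * μ η)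

/-- The weighted energy estimate for the transport operator. -/
theorem IsWeight.transport_le {k l : ℕ} {w : Freq → ℝ} (hw : IsWeight k l w) (hk : k ≤ 1)
    {u : Fin 2 → Freq → ℂ} (hu : IsSolenoidal u) (hu2 : sob 2 (modulus u) ≠ ⊤)
    {a D : Freq → ℂ} (ha : sob (k + 2) (fun ξ => ‖a ξ‖ₑ) ≠ ⊤)
    (hD : ∀ ξ, HasSum (fun η => transportKernel u ξ η * a η) (D ξ)) :
    2 * ‖(∑' ξ, (w ξ : ℂ) ^ 2 * (conj (a ξ) * D ξ)).re‖ₑ ≤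
      (1 + 19600 * embConst * sob 3 (modulus u)) * sob l (fun ξ => ‖a ξ‖ₑ) := by
  obtain ⟨N, hN, hwN⟩ := hw.bound
  obtain ⟨μ, hμ, hθ⟩ := hw.commutator
  have hE := embConst_ne_top
  have ha1 : sob (k + 1) (fun ξ => ‖a ξ‖ₑ) ≠ ⊤ := ne_top_of_le_ne_top ha (sob_mono (by lia) _)
  have hwa : sqSum (fun ξ => ‖w ξ‖ₑ * ‖a ξ‖ₑ) ≠ ⊤ := by
    refine ne_top_of_le_ne_top (ENNReal.mul_ne_top (ENNReal.pow_ne_top hN (n := 2)) ha1) ?_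
    rw [sob, ← sqSum_const_mul]
    refine sqSum_mono fun ξ => ?_
    rw [← mul_assoc]
    gcongr
    exact hwN ξ
  have hconv : sob (k + 1) (conv (modulus u) fun η => elam η * ‖a η‖ₑ) ≠ ⊤ := by
    refine ne_top_of_le_ne_top ?_ (sob_conv_le hk _ _)
    finiteness
  refine (enorm_re_tsum_weight_le hu.transportKernel_swap hD w ?_ ?_).trans ?_
  · have hB : sqSum (fun ξ => 7 * (N * (elam ξ ^ (k + 1) *
        conv (modulus u) (fun η => elam η * ‖a η‖ₑ) ξ))) ≠ ⊤ := by
      rw [sqSum_const_mul, sqSum_const_mul]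
      exact ENNReal.mul_ne_top (by finiteness) (ENNReal.mul_ne_top (by finiteness) hconv)
    refine ne_top_of_le_ne_top (tsum_mul_ne_top hwa hB) ?_
    rw [ENNReal.tsum_prod']
    refine ENNReal.tsum_le_tsum fun ξ => ?_
    simp only [conv, ← ENNReal.tsum_mul_left]
    refine ENNReal.tsum_le_tsum fun η => ?_
    simp only [enorm_mul, enorm_pow, RCLike.enorm_conj, enorm_complex_ofReal]
    calc ‖w ξ‖ₑ ^ 2 * (‖a ξ‖ₑ * (‖transportKernel u ξ η‖ₑ * ‖a η‖ₑ))
        = ‖w ξ‖ₑ * ‖a ξ‖ₑ * (‖w ξ‖ₑ * (‖transportKernel u ξ η‖ₑ * ‖a η‖ₑ)) := by ring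
      _ ≤ ‖w ξ‖ₑ * ‖a ξ‖ₑ * ((N * elam ξ ^ (k + 1)) *
          (7 * (elam η * modulus u (ξ - η)) * ‖a η‖ₑ)) := by
          gcongr
          · exact hwN ξ
          · exact enorm_transportKernel_le u ξ η
      _ = _ := by ring
  -- Here `w(η)` and the derivative in the kernel both fall on `a(η)`, which is why order `k + 2` is
  -- needed.
  · have hB : sqSum (conv (modulus u) (fun η => 7 * (N * (elam η ^ (k + 2) * ‖a η‖ₑ)))) ≠ ⊤ := by
      refine ne_top_of_le_ne_top ?_ (sqSum_conv_le _ _)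
      rw [sqSum_const_mul, sqSum_const_mul]
      refine ENNReal.mul_ne_top (ne_top_of_le_ne_top ?_ (tsum_sq_le_sob _))
        (ENNReal.mul_ne_top (by finiteness) (ENNReal.mul_ne_top (by finiteness) ha))
      finiteness
    refine ne_top_of_le_ne_top (tsum_mul_ne_top hwa hB) ?_
    rw [ENNReal.tsum_prod']
    refine ENNReal.tsum_le_tsum fun ξ => ?_
    simp only [conv, ← ENNReal.tsum_mul_left]
    refine ENNReal.tsum_le_tsum fun η => ?_
    simp only [enorm_mul, RCLike.enorm_conj, enorm_complex_ofReal]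
    calc ‖w ξ‖ₑ * ‖w η‖ₑ * (‖a ξ‖ₑ * (‖transportKernel u ξ η‖ₑ * ‖a η‖ₑ))
        ≤ ‖w ξ‖ₑ * (N * elam η ^ (k + 1)) * (‖a ξ‖ₑ *
          (7 * (elam η * modulus u (ξ - η)) * ‖a η‖ₑ)) := by
          gcongr
          · exact hwN η
          · exact enorm_transportKernel_le u ξ η
      _ = _ := by ring
  · rw [add_mul, one_mul]
    refine add_le_add (sqSum_mono fun ξ => by gcongr; exact hw.le ξ) ?_
    calc sqSum (fun ξ => ∑' η, ‖w ξ - w η‖ₑ * (‖transportKernel u ξ η‖ₑ * ‖a η‖ₑ))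
        ≤ sqSum (fun ξ => ∑' η, 7 * (‖w ξ - w η‖ₑ * elam η) * (modulus u (ξ - η) * ‖a η‖ₑ)) := by
          refine sqSum_mono fun ξ => ENNReal.tsum_le_tsum fun η => ?_
          calc ‖w ξ - w η‖ₑ * (‖transportKernel u ξ η‖ₑ * ‖a η‖ₑ)
              ≤ ‖w ξ - w η‖ₑ * (7 * (elam η * modulus u (ξ - η)) * ‖a η‖ₑ) := by
                gcongr
                exact enorm_transportKernel_le u ξ η
            _ = _ := by ring
      -- `70 = 7 · 10` combines the kernel bound with the commutator constant, and `4 · 70² =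
      -- 19600`.
      _ ≤ 4 * 70 ^ 2 * embConst * sob 3 (modulus u) * sob l (fun ξ => ‖a ξ‖ₑ) := by
          refine sqSum_commutator_le (μ := μ) (fun ξ η => ?_) hμ _ _
          calc 7 * (‖w ξ - w η‖ₑ * elam η) ≤ 7 * (10 *
                (elam (ξ - η) * elam η ^ l + elam (ξ - η) ^ 3 * μ η)) := by
                exact mul_le_mul_right (hθ ξ η) 7
            _ = _ := by ring
      _ = _ := by norm_num

/-! ### The admissible weights -/

theorem IsWeight.of_real {k l : ℕ} {w μ : Freq → ℝ} {N : ℝ} (hN : 0 ≤ N)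
    (hwN : ∀ ξ, |w ξ| ≤ N * lam ξ ^ (k + 1)) (hw : ∀ ξ, |w ξ| ≤ lam ξ ^ l) (hμ : ∀ ξ, 0 ≤ μ ξ)
    (hμl : ∀ ξ, lam ξ ^ 2 * μ ξ ≤ lam ξ ^ l)
    (hc : ∀ ξ η, |w ξ - w η| * lam η ≤
      10 * (lam (ξ - η) * lam η ^ l + lam (ξ - η) ^ 3 * μ η)) : IsWeight k l w where
  bound := by
    refine ⟨ENNReal.ofReal N, ENNReal.ofReal_ne_top, fun ξ => ?_⟩
    have := lam_pos ξ
    rw [elam, ← ENNReal.ofReal_pow (by positivity), ← ENNReal.ofReal_mul hN, ← ofReal_norm]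
    exact ENNReal.ofReal_le_ofReal (hwN ξ)
  le ξ := by
    have := lam_pos ξ
    rw [elam, ← ENNReal.ofReal_pow (by positivity), ← ofReal_norm]
    exact ENNReal.ofReal_le_ofReal (hw ξ)
  commutator := by
    refine ⟨fun ξ => ENNReal.ofReal (μ ξ), fun ξ => ?_, fun ξ η => ?_⟩
    · have := lam_pos ξ
      rw [elam, ← ENNReal.ofReal_pow (by positivity), ← ENNReal.ofReal_pow (by positivity),
        ← ENNReal.ofReal_mul (by positivity)]
      exact ENNReal.ofReal_le_ofReal (hμl ξ)
    · have h1 := lam_pos (ξ - η)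
      have h2 := lam_pos η
      have h3 := hμ η
      simp only [elam]
      rw [← ENNReal.ofReal_pow (by positivity), ← ENNReal.ofReal_pow (by positivity),
        ← ENNReal.ofReal_mul (by positivity), ← ENNReal.ofReal_mul (by positivity),
        ← ENNReal.ofReal_add (by positivity) (by positivity), ← ENNReal.ofReal_ofNat 10,
        ← ENNReal.ofReal_mul (by positivity), ← ofReal_norm, ← ENNReal.ofReal_mul (by positivity)]
      exact ENNReal.ofReal_le_ofReal (hc ξ η)

theorem isWeight_lam : IsWeight 0 1 lam := by
  refine IsWeight.of_real (μ := 0) (N := 1) zero_le_one (fun ξ => ?_) (fun ξ => ?_)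
    (fun ξ => le_rfl) (fun ξ => ?_) fun ξ η => ?_
  · simp [abs_of_pos (lam_pos ξ)]
  · simp [abs_of_pos (lam_pos ξ)]
  · simpa using (lam_pos ξ).le
  · have h := mul_le_mul_of_nonneg_right (abs_lam_sub_le ξ η) (lam_pos η).le
    have := mul_pos (lam_pos (ξ - η)) (lam_pos η)
    simp only [Pi.zero_apply]
    linarith

/-- Shared by both weights of order two: `d (d + 2y) y` contains the mixed term `d² y`, absorbed
into `d y²` and `d³`. The trailing `1` is the value of `μ`. -/
theorem order_two_commutator {x y d A : ℝ} (hy : 0 ≤ y) (hd : 0 ≤ d)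
    (hxy : x ≤ d + y) (hA : A ≤ d * (x + y)) : A * y ≤ 10 * (d * y ^ 2 + d ^ 3 * 1) := by
  have h1 : A * y ≤ d * (d + y + y) * y := by
    refine mul_le_mul_of_nonneg_right (hA.trans ?_) hy
    exact mul_le_mul_of_nonneg_left (by linarith) hd
  nlinarith [mul_nonneg hd (sq_nonneg (d - y)), mul_nonneg hd (sq_nonneg y),
    mul_nonneg hd (sq_nonneg d)]

theorem isWeight_lam_sq : IsWeight 1 2 fun ξ => lam ξ ^ 2 := by
  refine IsWeight.of_real (μ := 1) (N := 1) zero_le_one (fun ξ => ?_) (fun ξ => ?_)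
    (fun ξ => zero_le_one) (fun ξ => ?_) fun ξ η => ?_
  · simp
  · simp
  · simp
  · refine order_two_commutator (lam_pos η).le (lam_pos (ξ - η)).le
      (lam_le_add ξ η) ?_
    rw [sq_sub_sq, abs_mul, mul_comm, abs_of_pos (add_pos (lam_pos ξ) (lam_pos η))]
    exact mul_le_mul_of_nonneg_right (abs_lam_sub_le ξ η) (add_pos (lam_pos ξ) (lam_pos η)).le

theorem abs_min_lam_sub_le (N : ℝ) (ξ η : Freq) :
    |min (lam ξ) N - min (lam η) N| ≤ lam (ξ - η) := by
  refine (abs_min_sub_min_le_max _ _ _ _).trans ?_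
  simpa using abs_lam_sub_le ξ η

/-- For fixed `N` the weight grows only linearly, yet its increments obey the bound for `⟨ξ⟩²`
independently of `N`, because `min · N` is 1-Lipschitz. -/
theorem isWeight_lam_mul_min {N : ℝ} (hN : 0 ≤ N) :
    IsWeight 0 2 fun ξ => lam ξ * min (lam ξ) N := by
  have hm : ∀ ξ, 0 ≤ min (lam ξ) N := fun ξ => le_min (lam_pos ξ).le hN
  have hl : ∀ ξ, 0 ≤ lam ξ := fun ξ => (lam_pos ξ).le
  refine IsWeight.of_real (μ := 1) (N := N) hN (fun ξ => ?_) (fun ξ => ?_)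
    (fun ξ => zero_le_one) (fun ξ => ?_) fun ξ η => ?_
  · rw [abs_of_nonneg (mul_nonneg (hl ξ) (hm ξ)), zero_add, pow_one, mul_comm]
    exact mul_le_mul_of_nonneg_right (min_le_right _ _) (hl ξ)
  · rw [abs_of_nonneg (mul_nonneg (hl ξ) (hm ξ)), sq]
    exact mul_le_mul_of_nonneg_left (min_le_left _ _) (hl ξ)
  · simp
  · refine order_two_commutator (hl η) (hl (ξ - η)) (lam_le_add ξ η) ?_
    have h1 := abs_lam_sub_le ξ η
    have h2 := abs_min_lam_sub_le N ξ η
    calc |lam ξ * min (lam ξ) N - lam η * min (lam η) N|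
        = |(lam ξ - lam η) * min (lam ξ) N + lam η * (min (lam ξ) N - min (lam η) N)| := by
          congr 1; ring
      _ ≤ |lam ξ - lam η| * min (lam ξ) N + lam η * |min (lam ξ) N - min (lam η) N| := by
          refine (abs_add_le _ _).trans_eq ?_
          rw [abs_mul, abs_mul, abs_of_nonneg (hm ξ), abs_of_nonneg (hl η)]
      _ ≤ lam (ξ - η) * lam ξ + lam η * lam (ξ - η) :=
          add_le_add (mul_le_mul h1 (min_le_left _ _) (hm ξ) (hl _))
            (mul_le_mul_of_nonneg_left h2 (hl η))
      _ = _ := by ring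

theorem isWeight_lam_sq_mul_min {N : ℝ} (hN : 0 ≤ N) :
    IsWeight 1 3 fun ξ => lam ξ ^ 2 * min (lam ξ) N := by
  have hm : ∀ ξ, 0 ≤ min (lam ξ) N := fun ξ => le_min (lam_pos ξ).le hN
  have hl : ∀ ξ, 0 ≤ lam ξ := fun ξ => (lam_pos ξ).le
  -- At order three the commutator also leaves `d³ y`, hence `μ = lam`, the largest choice allowed
  -- by `⟨η⟩² μ ≤ ⟨η⟩³`.
  refine IsWeight.of_real (μ := lam) (N := N) hN (fun ξ => ?_) (fun ξ => ?_)
    hl (fun ξ => ?_) fun ξ η => ?_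
  · rw [abs_of_nonneg (mul_nonneg (sq_nonneg _) (hm ξ)), mul_comm]
    exact mul_le_mul_of_nonneg_right (min_le_right _ _) (sq_nonneg _)
  · rw [abs_of_nonneg (mul_nonneg (sq_nonneg _) (hm ξ)), pow_succ]
    exact mul_le_mul_of_nonneg_left (min_le_left _ _) (sq_nonneg _)
  · exact (pow_succ _ _).ge
  · have h1 := abs_lam_sub_le ξ η
    have h2 := abs_min_lam_sub_le N ξ η
    have h3 := lam_le_add ξ η
    have hx := hl ξ
    have hy := hl η
    have hd := hl (ξ - η)
    generalize lam (ξ - η) = d at *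
    have h4 : |lam ξ ^ 2 * min (lam ξ) N - lam η ^ 2 * min (lam η) N| ≤
        d * (lam ξ + lam η) * lam ξ + lam η ^ 2 * d := by
      calc |lam ξ ^ 2 * min (lam ξ) N - lam η ^ 2 * min (lam η) N|
          = |(lam ξ - lam η) * (lam ξ + lam η) * min (lam ξ) N +
              lam η ^ 2 * (min (lam ξ) N - min (lam η) N)| := by congr 1; ring
        _ ≤ |lam ξ - lam η| * (lam ξ + lam η) * min (lam ξ) N +
              lam η ^ 2 * |min (lam ξ) N - min (lam η) N| := by
            refine (abs_add_le _ _).trans_eq ?_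
            rw [abs_mul, abs_mul, abs_mul, abs_of_nonneg (hm ξ), abs_of_nonneg (add_nonneg hx hy),
              abs_of_nonneg (sq_nonneg (lam η))]
        _ ≤ _ := by
            have := hm ξ
            gcongr
            exact min_le_left _ _
    generalize lam ξ = x at *
    generalize lam η = y at *
    have h5 : d * (x + y) * x + y ^ 2 * d ≤ d * (d + y + y) * (d + y) + y ^ 2 * d := by
      gcongr
    refine (mul_le_mul_of_nonneg_right (h4.trans h5) hy).trans ?_
    have h6 : 0 ≤ d * y := mul_nonneg hd hy
    nlinarith [mul_nonneg h6 (sq_nonneg (d - y)), mul_nonneg h6 (sq_nonneg d),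
      mul_nonneg h6 (sq_nonneg y)]

/-! ### Fourier coefficients and weak derivatives -/

/-- The Fourier coefficients of a real function on the torus. -/
def coeff (h : Torus → ℝ) (ξ : Freq) : ℂ := ∫ x, mFourier (-ξ) x * (h x : ℂ) ∂vol

theorem fourierCoeff_eq_coeff (v : L2) (ξ : Freq) : fourierCoeff v ξ = coeff v ξ := rfl

theorem norm_mFourier_apply (n : Freq) (x : Torus) : ‖mFourier n x‖ = 1 := by
  simp only [mFourier, ContinuousMap.coe_mk, norm_prod, fourier_apply, Circle.norm_coe,
    Finset.prod_const_one]

theorem integrable_mFourier_mul {h : Torus → ℝ} (hh : Integrable h vol) (n : Freq) :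
    Integrable (fun x => mFourier n x * (h x : ℂ)) vol := by
  refine hh.ofReal.bdd_mul (c := 1) (mFourier n).continuous.aestronglyMeasurable ?_
  exact Eventually.of_forall fun x => (norm_mFourier_apply n x).le

theorem coeff_neg (h : Torus → ℝ) (ξ : Freq) : coeff h (-ξ) = conj (coeff h ξ) := by
  rw [coeff, coeff, ← integral_conj]
  refine integral_congr_ae (Eventually.of_forall fun x => ?_)
  simp only [map_mul, Complex.conj_ofReal, mFourier_neg, Complex.conj_conj, neg_neg]

theorem integrable_coe (v : L2) : Integrable v vol :=
  (Lp.memLp v).integrable one_le_two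

theorem integrable_mul (v q : L2) : Integrable (fun x => v x * q x) vol :=
  (Lp.memLp v).integrable_mul (Lp.memLp q)

/-- Real trigonometric test functions. -/
def trig (n : Freq) (c : ℂ) (x : Torus) : ℝ := (c * mFourier n x).re

theorem isTest_trig (n : Freq) (c : ℂ) : IsTest (trig n c) := by
  unfold IsTest trig
  simp only [mFourier, ContinuousMap.coe_mk, fourier_coe_apply, Fin.prod_univ_two]
  have h : ∀ j : Fin 2, ContDiff ℝ ((⊤ : ℕ∞) : WithTop ℕ∞) fun y : Fin 2 → ℝ =>
      Complex.exp (2 * Real.pi * Complex.I * n j * (y j : ℂ) / (1 : ℝ)) := fun j => by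
    refine ContDiff.cexp (ContDiff.div_const (ContDiff.mul contDiff_const ?_) _)
    exact Complex.ofRealCLM.contDiff.comp (contDiff_apply ℝ ℝ j)
  exact Complex.reCLM.contDiff.comp (contDiff_const.mul ((h 0).mul (h 1)))

theorem mFourier_add_single (n : Freq) (x : Torus) (j : Fin 2) (s : UnitAddCircle) :
    mFourier n (x + Pi.single j s) = mFourier n x * fourier (n j) s := by
  simp only [mFourier, ContinuousMap.coe_mk, fourier_apply, Pi.add_apply, smul_add,
    AddCircle.toCircle_add, Circle.coe_mul, Finset.prod_mul_distrib]
  congr 1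
  rw [Finset.prod_eq_single j]
  · simp
  · intro i _ hi
    simp [Pi.single_eq_of_ne hi]
  · simp

theorem partialDeriv_trig (j : Fin 2) (n : Freq) (c : ℂ) :
    partialDeriv j (trig n c) = trig n (c * (2 * Real.pi * Complex.I * n j)) := by
  funext x
  have h1 := hasDerivAt_fourier 1 (n j) 0
  have h2 := (h1.const_mul (c * mFourier n x))
  have h3 := Complex.reCLM.hasFDerivAt.comp_hasDerivAt (0 : ℝ) h2
  unfold partialDeriv
  have h4 : (fun s : ℝ => trig n c (x + Pi.single j (s : UnitAddCircle))) =
      (Complex.reCLM ∘ fun y : ℝ => c * mFourier n x * fourier (n j) (y : AddCircle (1 : ℝ))) := by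
    funext s
    simp only [trig, mFourier_add_single, Function.comp_apply, Complex.reCLM_apply, mul_assoc]
  rw [h4, h3.deriv]
  simp only [trig, Complex.reCLM_apply, AddCircle.coe_zero, fourier_eval_zero]
  congr 1
  push_cast
  ring

theorem laplacian_trig (n : Freq) (c : ℂ) :
    laplacian (trig n c) = trig n (c * -(4 * Real.pi ^ 2 * ∑ i, (n i : ℂ) ^ 2)) := by
  funext x
  simp only [laplacian, partialDeriv_trig, trig, ← Complex.re_sum, ← Finset.sum_mul]
  congr 2
  simp only [Fin.sum_univ_two]
  ring_nf
  simp only [Complex.I_sq]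
  ring

theorem integral_mul_trig {h : Torus → ℝ} (hh : Integrable h vol) (ξ : Freq) (c : ℂ) :
    ∫ x, h x * trig (-ξ) c x ∂vol = (c * coeff h ξ).re := by
  rw [coeff, ← integral_const_mul]
  rw [← RCLike.re_eq_complex_re, ← integral_re ((integrable_mFourier_mul hh _).const_mul c)]
  refine integral_congr_ae (Eventually.of_forall fun x => ?_)
  simp only [trig, RCLike.re_eq_complex_re, ← mul_assoc, Complex.re_mul_ofReal]
  ring

theorem integrable_mul_trig {h : Torus → ℝ} (hh : Integrable h vol) (n : Freq) (c : ℂ) :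
    Integrable (fun x => h x * trig n c x) vol := by
  refine ((integrable_mFourier_mul hh n).const_mul c).re.congr
    (Eventually.of_forall fun x => ?_)
  simp only [trig, RCLike.re_eq_complex_re, ← mul_assoc, Complex.re_mul_ofReal]
  ring

/-- The test functions are real; letting the amplitude `c` of `trig` range over `ℂ` recovers both
parts of an identity between Fourier coefficients. -/
theorem eq_of_forall_re_mul {z w : ℂ} (h : ∀ c : ℂ, (c * z).re = (c * w).re) : z = w := by
  apply Complex.ext
  · simpa using h 1
  · simpa using h (-Complex.I)

theorem IsWeakPartial.fourierCoeff {j : Fin 2} {v g : L2} (h : IsWeakPartial j v g) (ξ : Freq) :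
    TQG.fourierCoeff g ξ = 2 * Real.pi * Complex.I * ξ j * TQG.fourierCoeff v ξ := by
  refine eq_of_forall_re_mul fun c => ?_
  have h1 := h (trig (-ξ) c) (isTest_trig _ _)
  rw [partialDeriv_trig, integral_mul_trig (integrable_coe _), integral_mul_trig (integrable_coe _),
    ← fourierCoeff_eq_coeff, ← fourierCoeff_eq_coeff] at h1
  rw [eq_neg_iff_add_eq_zero, add_comm, ← eq_neg_iff_add_eq_zero] at h1
  rw [h1, ← Complex.neg_re]
  congr 1
  simp only [Pi.neg_apply, Int.cast_neg]
  ring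

theorem IsWeakDiv.fourierCoeff {F : Torus → Fin 2 → ℝ} {g : L2} (h : IsWeakDiv F g)
    (hF : ∀ j, Integrable (fun x => F x j) vol) (ξ : Freq) :
    TQG.fourierCoeff g ξ =
      2 * Real.pi * Complex.I * ∑ j, (ξ j : ℂ) * coeff (fun x => F x j) ξ := by
  refine eq_of_forall_re_mul fun c => ?_
  have h1 := h (trig (-ξ) c) (isTest_trig _ _)
  simp only [partialDeriv_trig] at h1
  rw [integral_finsetSum _ fun j _ => integrable_mul_trig (hF j) _ _] at h1
  simp only [fun j => integral_mul_trig (hF j) ξ] at h1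
  rw [integral_mul_trig (integrable_coe _), ← fourierCoeff_eq_coeff] at h1
  rw [eq_neg_iff_add_eq_zero, add_comm, ← eq_neg_iff_add_eq_zero] at h1
  rw [h1, ← Complex.re_sum, ← Complex.neg_re]
  congr 1
  simp only [Pi.neg_apply, Int.cast_neg, Fin.sum_univ_two]
  ring

theorem IsStreamfunction.fourierCoeff {f ω ψ : L2} (h : IsStreamfunction f ω ψ) (ξ : Freq) :
    (1 + 4 * Real.pi ^ 2 * ∑ i, (ξ i : ℂ) ^ 2) * TQG.fourierCoeff ψ ξ =
      -(TQG.fourierCoeff ω ξ - TQG.fourierCoeff f ξ) := by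
  refine eq_of_forall_re_mul fun c => ?_
  have h1 := h (trig (-ξ) c) (isTest_trig _ _)
  have e1 : ∀ x, laplacian (trig (-ξ) c) x - trig (-ξ) c x =
      trig (-ξ) (c * -(1 + 4 * Real.pi ^ 2 * ∑ i, (ξ i : ℂ) ^ 2)) x := fun x => by
    rw [laplacian_trig]
    simp only [trig, ← Complex.sub_re]
    congr 1
    simp only [Pi.neg_apply, Int.cast_neg, neg_sq]
    ring
  simp only [e1, sub_mul] at h1
  rw [integral_mul_trig (integrable_coe _),
    integral_sub (integrable_mul_trig (integrable_coe _) _ _)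
    (integrable_mul_trig (integrable_coe _) _ _), integral_mul_trig (integrable_coe _),
    integral_mul_trig (integrable_coe _), ← fourierCoeff_eq_coeff, ← fourierCoeff_eq_coeff,
    ← fourierCoeff_eq_coeff, ← Complex.sub_re] at h1
  have e2 : ∀ a b : ℂ, c * (a * b) = -(c * -a * b) := fun a b => by ring
  rw [e2, Complex.neg_re, h1, ← Complex.neg_re]
  congr 1
  ring

/-- The convolution theorem for the product of two square-integrable functions. -/
theorem hasSum_coeff_mul (v q : L2) (ξ : Freq) :
    HasSum (fun η => fourierCoeff v (ξ - η) * fourierCoeff q η) (coeff (fun x => v x * q x) ξ) := by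
  -- Parseval is applied to `e_ξ v` and `q`. The coefficient of `e_ξ v` at `η` is `v̂(η-ξ)`, whose
  -- conjugate is `v̂(ξ-η)` because `v` is real.
  have m1 : MemLp (fun x => mFourier ξ x * (v x : ℂ)) 2 vol := by
    refine MemLp.of_le ((Lp.memLp v).ofReal (K := ℂ))
      ((mFourier ξ).continuous.aestronglyMeasurable.mul ((Lp.memLp v).ofReal (K := ℂ)).1) ?_
    exact Eventually.of_forall fun x => by rw [norm_mul, norm_mFourier_apply, one_mul]; rfl
  have m2 : MemLp (fun x => (q x : ℂ)) 2 vol := (Lp.memLp q).ofReal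
  have h := hasSum_prod_mFourierCoeff (m1.toLp _) (m2.toLp _)
  have e1 : ∀ η, mFourierCoeff (m1.toLp _) η = fourierCoeff v (η - ξ) := fun η => by
    refine integral_congr_ae ?_
    filter_upwards [m1.coeFn_toLp] with x hx
    rw [hx, smul_eq_mul, smul_eq_mul, ← mul_assoc, ← mFourier_add]
    congr 3
    abel
  have e2 : ∀ η, mFourierCoeff (m2.toLp _) η = fourierCoeff q η := fun η => by
    refine integral_congr_ae ?_
    filter_upwards [m2.coeFn_toLp] with x hx
    rw [hx]
  simp only [e1, e2] at h
  have e3 : ∀ η, conj (fourierCoeff v (η - ξ)) = fourierCoeff v (ξ - η) := fun η => by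
    rw [fourierCoeff_eq_coeff, ← coeff_neg, neg_sub, ← fourierCoeff_eq_coeff]
  simp only [e3] at h
  convert h using 1
  refine integral_congr_ae ?_
  filter_upwards [m1.coeFn_toLp, m2.coeFn_toLp] with x hx1 hx2
  rw [hx1, hx2, map_mul, Complex.conj_ofReal, mFourier_neg]
  push_cast
  ring

/-! ### Linearity of the Fourier coefficients -/

theorem norm_coeff_le (h : Torus → ℝ) (ξ : Freq) : ‖coeff h ξ‖ ≤ ∫ x, ‖h x‖ ∂vol := by
  refine (norm_integral_le_integral_norm _).trans_eq ?_
  simp only [norm_mul, norm_mFourier_apply, one_mul, Complex.norm_real]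

theorem coeff_add {g h : Torus → ℝ} (hg : Integrable g vol) (hh : Integrable h vol) (ξ : Freq) :
    coeff (fun x => g x + h x) ξ = coeff g ξ + coeff h ξ := by
  rw [coeff, coeff, coeff, ← integral_add (integrable_mFourier_mul hg _)
    (integrable_mFourier_mul hh _)]
  simp only [Complex.ofReal_add, mul_add]

theorem coeff_congr {g h : Torus → ℝ} (H : g =ᵐ[vol] h) (ξ : Freq) : coeff g ξ = coeff h ξ :=
  integral_congr_ae (H.mono fun x hx => by simp only [hx])

/-- The Fourier coefficient as a continuous real-linear functional on `L²`. -/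
def fourierCLM (ξ : Freq) : L2 →L[ℝ] ℂ :=
  LinearMap.mkContinuous
    { toFun := fun v => fourierCoeff v ξ
      map_add' := fun v w => by
        rw [fourierCoeff_eq_coeff, coeff_congr (Lp.coeFn_add v w)]
        exact coeff_add (integrable_coe v) (integrable_coe w) ξ
      map_smul' := fun c v => by
        rw [fourierCoeff_eq_coeff, coeff_congr (Lp.coeFn_smul c v), RingHom.id_apply,
          fourierCoeff_eq_coeff, coeff, coeff, ← integral_smul]
        refine integral_congr_ae (Eventually.of_forall fun x => ?_)
        simp only [Pi.smul_apply, smul_eq_mul, Complex.ofReal_mul, Complex.real_smul]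
        ring } 1 fun v => by
    rw [one_mul]
    refine (norm_coeff_le v ξ).trans ?_
    rw [Lp.norm_def, integral_norm_eq_lintegral_enorm (integrable_coe v).1,
      ← eLpNorm_one_eq_lintegral_enorm]
    refine ENNReal.toReal_mono (Lp.eLpNorm_ne_top v) ?_
    exact eLpNorm_le_eLpNorm_of_exponent_le one_le_two (integrable_coe v).1

theorem fourierCLM_apply (ξ : Freq) (v : L2) : fourierCLM ξ v = fourierCoeff v ξ := rfl

theorem fourierCoeff_sub (v w : L2) (ξ : Freq) :
    fourierCoeff (v - w) ξ = fourierCoeff v ξ - fourierCoeff w ξ :=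
  map_sub (fourierCLM ξ) v w

theorem fourierCoeff_zero (ξ : Freq) : fourierCoeff 0 ξ = 0 := map_zero (fourierCLM ξ)

theorem fourierCoeff_neg_apply (v : L2) (ξ : Freq) : fourierCoeff (-v) ξ = -fourierCoeff v ξ :=
  map_neg (fourierCLM ξ) v

/-- The Fourier coefficients of a vector field. -/
def vecCoeff (u : Fin 2 → L2) (j : Fin 2) (ξ : Freq) : ℂ := fourierCoeff (u j) ξ

theorem vecCoeff_sub (u v : Fin 2 → L2) (j : Fin 2) (ξ : Freq) :
    vecCoeff (u - v) j ξ = vecCoeff u j ξ - vecCoeff v j ξ :=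
  fourierCoeff_sub _ _ _

theorem isSolenoidal_iff (u : Fin 2 → L2) :
    IsSolenoidal (vecCoeff u) ↔ ∀ ξ : Freq, ∑ j, (ξ j : ℂ) * vecCoeff u j ξ = 0 :=
  ⟨fun h => h.div_free, fun h => ⟨fun j ξ => coeff_neg (u j) ξ, h⟩⟩

theorem IsSolenoidal.sub {u v : Fin 2 → L2} (hu : IsSolenoidal (vecCoeff u))
    (hv : IsSolenoidal (vecCoeff v)) : IsSolenoidal (vecCoeff (u - v)) := by
  rw [isSolenoidal_iff]
  intro ξ
  simp only [vecCoeff_sub, mul_sub, Finset.sum_sub_distrib, hu.div_free, hv.div_free, sub_zero]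

theorem MemSobolevDiv.isSolenoidal {k : ℕ} {w : Fin 2 → L2} (hw : MemSobolevDiv k w) :
    IsSolenoidal (vecCoeff w) := by
  rw [isSolenoidal_iff]
  intro ξ
  have h := hw.2.fourierCoeff (fun j => integrable_coe (w j)) ξ
  rw [fourierCoeff_zero] at h
  exact (mul_eq_zero.1 h.symm).resolve_left Complex.two_pi_I_ne_zero

/-- The Fourier coefficients of `div (q u)`. -/
def divCoeff (u : Fin 2 → L2) (q : L2) (ξ : Freq) : ℂ :=
  2 * Real.pi * Complex.I * ∑ j, (ξ j : ℂ) * coeff (fun x => q x * u j x) ξ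

/-- The convolution theorem produces the symbol `ξ·û(ξ-η)`; the divergence-free condition replaces
`ξ` by `η`, that is, `div (q u) = u · ∇q`. -/
theorem hasSum_divCoeff {u : Fin 2 → L2} (hu : IsSolenoidal (vecCoeff u)) (q : L2) (ξ : Freq) :
    HasSum (fun η => transportKernel (vecCoeff u) ξ η * fourierCoeff q η) (divCoeff u q ξ) := by
  have h1 : ∀ j ∈ Finset.univ, HasSum (fun η => (ξ j : ℂ) *
      (vecCoeff u j (ξ - η) * fourierCoeff q η))
      ((ξ j : ℂ) * coeff (fun x => q x * u j x) ξ) := fun j _ => by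
    have := (hasSum_coeff_mul (u j) q ξ).mul_left (ξ j : ℂ)
    simp only [mul_comm (u j _)] at this
    exact this
  refine ((hasSum_sum h1).mul_left (2 * Real.pi * Complex.I)).congr_fun fun η => ?_
  have h2 := hu.div_free (ξ - η)
  simp only [transportKernel, Fin.sum_univ_two, Pi.sub_apply, Int.cast_sub] at h2 ⊢
  linear_combination (-2 * Real.pi * Complex.I * fourierCoeff q η) * h2

/-- The splitting is deliberately asymmetric: the difference `p - q` is transported by `v`, and the
difference of velocities acts only on `p`. -/
theorem divCoeff_sub {u v : Fin 2 → L2} (hu : IsSolenoidal (vecCoeff u))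
    (hv : IsSolenoidal (vecCoeff v)) (p q : L2) (ξ : Freq) :
    divCoeff u p ξ - divCoeff v q ξ = divCoeff v (p - q) ξ + divCoeff (u - v) p ξ := by
  refine HasSum.unique ((hasSum_divCoeff hu p ξ).sub (hasSum_divCoeff hv q ξ)) ?_
  refine ((hasSum_divCoeff hv (p - q) ξ).add (hasSum_divCoeff (hu.sub hv) p ξ)).congr_fun
    fun η => ?_
  simp only [transportKernel, fourierCoeff_sub, vecCoeff_sub, Fin.sum_univ_two]
  ring

theorem IsWeakDiv.fourierCoeff_eq_divCoeff {u : Fin 2 → L2} {q g : L2}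
    (h : IsWeakDiv (fun x j => q x * u j x) g) (ξ : Freq) :
    TQG.fourierCoeff g ξ = divCoeff u q ξ :=
  h.fourierCoeff (fun j => integrable_mul q (u j)) ξ

theorem IsWeakDiv.fourierCoeff_eq_divCoeff_add {u v : Fin 2 → L2} {p q g : L2}
    (h : IsWeakDiv (fun x j => (p x - q x) * u j x + q x * v j x) g) (ξ : Freq) :
    TQG.fourierCoeff g ξ = divCoeff u (p - q) ξ + divCoeff v q ξ := by
  have h1 : ∀ j, (fun x => (p x - q x) * u j x) =ᵐ[vol] fun x => (p - q : L2) x * u j x :=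
    fun j => by
      filter_upwards [Lp.coeFn_sub p q] with x hx
      rw [hx, Pi.sub_apply]
  have h2 : ∀ j, Integrable (fun x => (p x - q x) * u j x) vol := fun j =>
    (integrable_mul (p - q) (u j)).congr (h1 j).symm
  rw [h.fourierCoeff (fun j => (h2 j).add (integrable_mul q (v j))), divCoeff, divCoeff, ← mul_add,
    ← Finset.sum_add_distrib]
  congr 1
  refine Finset.sum_congr rfl fun j _ => ?_
  rw [coeff_add (h2 j) (integrable_mul q (v j)), coeff_congr (h1 j), mul_add]

/-! ### The velocity -/

/-- The relation `u = ∇^⊥ (Δ - 1)⁻¹ g` between Fourier coefficients. -/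
def IsBiotSavart (u : Fin 2 → Freq → ℂ) (g : Freq → ℂ) : Prop :=
  ∀ ξ : Freq,
    (1 + 4 * Real.pi ^ 2 * ∑ i, (ξ i : ℂ) ^ 2) * u 0 ξ = 2 * Real.pi * Complex.I * ξ 1 * g ξ ∧
    (1 + 4 * Real.pi ^ 2 * ∑ i, (ξ i : ℂ) ^ 2) * u 1 ξ = -(2 * Real.pi * Complex.I * ξ 0 * g ξ)

theorem IsVelocity.isBiotSavart {f ω : L2} {u : Fin 2 → L2} (h : IsVelocity f ω u) :
    IsBiotSavart (vecCoeff u) (fourierCoeff (ω - f)) := by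
  obtain ⟨ψ, h1, h2, h3⟩ := h
  intro ξ
  have e1 := h1.fourierCoeff ξ
  have e2 := h2.fourierCoeff ξ
  have e3 := h3.fourierCoeff ξ
  rw [fourierCoeff_neg_apply] at e2
  rw [fourierCoeff_sub]
  simp only [vecCoeff]
  constructor
  · linear_combination (-(1 + 4 * Real.pi ^ 2 * ∑ i, (ξ i : ℂ) ^ 2)) * e2 -
      (2 * Real.pi * Complex.I * ξ 1) * e1
  · linear_combination (1 + 4 * Real.pi ^ 2 * ∑ i, (ξ i : ℂ) ^ 2) * e3 +
      (2 * Real.pi * Complex.I * ξ 0) * e1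

theorem IsVelocity.isBiotSavart_sub {f ω₁ ω₂ : L2} {u₁ u₂ : Fin 2 → L2} (h₁ : IsVelocity f ω₁ u₁)
    (h₂ : IsVelocity f ω₂ u₂) : IsBiotSavart (vecCoeff (u₁ - u₂)) (fourierCoeff (ω₁ - ω₂)) := by
  intro ξ
  have e1 := h₁.isBiotSavart ξ
  have e2 := h₂.isBiotSavart ξ
  simp only [fourierCoeff_sub, vecCoeff_sub] at *
  constructor
  · linear_combination e1.1 - e2.1
  · linear_combination e1.2 - e2.2

theorem laplaceSymbol_eq (ξ : Freq) : (1 + 4 * Real.pi ^ 2 * ∑ i, (ξ i : ℂ) ^ 2) =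
    ((1 + 4 * Real.pi ^ 2 * ∑ i, (ξ i : ℝ) ^ 2 : ℝ) : ℂ) := by
  push_cast
  rfl

theorem laplaceSymbol_pos (ξ : Freq) : 0 < 1 + 4 * Real.pi ^ 2 * ∑ i, (ξ i : ℝ) ^ 2 := by
  positivity

theorem IsVelocity.isSolenoidal {f ω : L2} {u : Fin 2 → L2} (h : IsVelocity f ω u) :
    IsSolenoidal (vecCoeff u) := by
  rw [isSolenoidal_iff]
  intro ξ
  have h0 : (1 + 4 * Real.pi ^ 2 * ∑ i, (ξ i : ℂ) ^ 2) ≠ 0 := by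
    rw [laplaceSymbol_eq]
    exact_mod_cast (laplaceSymbol_pos ξ).ne'
  refine (mul_eq_zero.1 ?_).resolve_left h0
  obtain ⟨h1, h2⟩ := h.isBiotSavart ξ
  rw [Fin.sum_univ_two (fun j => (ξ j : ℂ) * vecCoeff u j ξ)]
  linear_combination (ξ 0 : ℂ) * h1 + (ξ 1 : ℂ) * h2

/-- This is the gain of one derivative by `∇(1-Δ)⁻¹`. The symbol contains `4π²|ξ|²` but the weight
only `|ξ|²`; `4π² ≥ 1` reconciles them. -/
theorem lam_mul_coord_le (ξ : Freq) (j : Fin 2) :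
    lam ξ * (2 * Real.pi * |(ξ j : ℝ)|) ≤ 1 + 4 * Real.pi ^ 2 * ∑ i, (ξ i : ℝ) ^ 2 := by
  have h1 : |(ξ j : ℝ)| ^ 2 ≤ ∑ i, (ξ i : ℝ) ^ 2 := by
    rw [sq_abs]
    exact Finset.single_le_sum (f := fun i => (ξ i : ℝ) ^ 2) (fun i _ => sq_nonneg _)
      (Finset.mem_univ j)
  refine le_of_sq_le_sq ?_ (laplaceSymbol_pos ξ).le
  have h2 := lam_sq ξ
  have h3 : (lam ξ * (2 * Real.pi * |(ξ j : ℝ)|)) ^ 2 =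
      lam ξ ^ 2 * (4 * Real.pi ^ 2 * |(ξ j : ℝ)| ^ 2) := by ring
  rw [h3, h2]
  set S := ∑ i, (ξ i : ℝ) ^ 2
  have hS : 0 ≤ S := (sq_nonneg _).trans h1
  have hpi : 1 ≤ 4 * Real.pi ^ 2 := by nlinarith [Real.pi_gt_three]
  set P := 4 * Real.pi ^ 2
  calc (1 + S) * (P * |(ξ j : ℝ)| ^ 2) ≤ (1 + S) * (P * S) := by gcongr
    _ ≤ (1 + P * S) * (1 + P * S) := by
      have : S ≤ P * S := le_mul_of_one_le_left hS hpi
      gcongr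
      linarith
    _ = _ := by ring

theorem IsBiotSavart.elam_mul_modulus_le {u : Fin 2 → Freq → ℂ} {g : Freq → ℂ}
    (h : IsBiotSavart u g) (ξ : Freq) : elam ξ * modulus u ξ ≤ 2 * ‖g ξ‖ₑ := by
  obtain ⟨h1, h2⟩ := h ξ
  have key : ∀ (j : Fin 2) (z : ℂ),
      ‖(1 + 4 * Real.pi ^ 2 * ∑ i, (ξ i : ℂ) ^ 2) * z‖ = ‖2 * Real.pi * Complex.I * ξ j * g ξ‖ →
      elam ξ * ‖z‖ₑ ≤ ‖g ξ‖ₑ := by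
    intro j z hz
    rw [laplaceSymbol_eq, norm_mul, Complex.norm_real, Real.norm_of_nonneg (laplaceSymbol_pos ξ).le]
      at hz
    simp only [Complex.norm_mul, Complex.norm_ofNat, Complex.norm_real, Complex.norm_I, mul_one,
      Real.norm_of_nonneg Real.pi_pos.le, Complex.norm_intCast] at hz
    rw [elam, ← ofReal_norm, ← ofReal_norm, ← ENNReal.ofReal_mul (lam_pos ξ).le]
    refine ENNReal.ofReal_le_ofReal (le_of_mul_le_mul_left ?_ (laplaceSymbol_pos ξ))
    rw [mul_left_comm, hz]
    calc lam ξ * (2 * Real.pi * |(ξ j : ℝ)| * ‖g ξ‖)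
        = lam ξ * (2 * Real.pi * |(ξ j : ℝ)|) * ‖g ξ‖ := by ring
      _ ≤ _ := by
        gcongr
        exact lam_mul_coord_le ξ j
  rw [modulus, Fin.sum_univ_two, mul_add, two_mul]
  refine add_le_add (key 1 _ (by rw [h1])) (key 0 _ (by rw [h2, norm_neg]))

theorem IsBiotSavart.sob_modulus_le {u : Fin 2 → Freq → ℂ} {g : Freq → ℂ}
    (h : IsBiotSavart u g) (k : ℕ) :
    sob (k + 1) (modulus u) ≤ 4 * sob k (fun ξ => ‖g ξ‖ₑ) := by
  have : (4 : ℝ≥0∞) = 2 ^ 2 := by norm_num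
  rw [this, sob, sob, ← sqSum_const_mul]
  refine sqSum_mono fun ξ => ?_
  rw [pow_succ, mul_assoc, mul_left_comm 2]
  exact mul_le_mul_right (h.elam_mul_modulus_le ξ) _

/-! ### Sobolev norms -/

/-- The squared norm of `W^{k,2}` with values in `[0,∞]`. -/
def sobSq (k : ℕ) (v : L2) : ℝ≥0∞ := sob k fun ξ => ‖fourierCoeff v ξ‖ₑ

theorem ofReal_sobolevTerm (k : ℕ) (v : L2) (ξ : Freq) :
    ENNReal.ofReal (sobolevTerm k v ξ) = (elam ξ ^ k * ‖fourierCoeff v ξ‖ₑ) ^ 2 := by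
  have := lam_pos ξ
  rw [elam, ← ofReal_norm, ← ENNReal.ofReal_pow (by positivity),
    ← ENNReal.ofReal_mul (by positivity), ← ENNReal.ofReal_pow (by positivity), sobolevTerm,
    ← lam_sq]
  congr 1
  ring

theorem sobolevTerm_nonneg (k : ℕ) (v : L2) (ξ : Freq) : 0 ≤ sobolevTerm k v ξ := by
  unfold sobolevTerm
  positivity

theorem memSobolev_iff {k : ℕ} {v : L2} : MemSobolev k v ↔ sobSq k v ≠ ⊤ := by
  have h : sobSq k v = ∑' ξ, ENNReal.ofReal (sobolevTerm k v ξ) :=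
    tsum_congr fun ξ => (ofReal_sobolevTerm k v ξ).symm
  rw [h]
  refine ⟨fun hs => Summable.tsum_ofReal_ne_top hs, fun ht => ?_⟩
  refine (ENNReal.summable_toReal ht).congr fun ξ => ?_
  rw [ENNReal.toReal_ofReal (sobolevTerm_nonneg k v ξ)]

theorem sobolevNorm_sq {k : ℕ} {v : L2} (h : MemSobolev k v) :
    ENNReal.ofReal (sobolevNorm k v ^ 2) = sobSq k v := by
  rw [sobolevNorm, Real.sq_sqrt (tsum_nonneg (sobolevTerm_nonneg k v)),
    ENNReal.ofReal_tsum_of_nonneg (sobolevTerm_nonneg k v) h]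
  exact tsum_congr fun ξ => ofReal_sobolevTerm k v ξ

theorem sobSq_mono {k l : ℕ} (h : k ≤ l) (v : L2) : sobSq k v ≤ sobSq l v := sob_mono h _

theorem MemSobolev.mono {k l : ℕ} {v : L2} (hv : MemSobolev l v) (h : k ≤ l) : MemSobolev k v :=
  memSobolev_iff.2 (ne_top_of_le_ne_top (memSobolev_iff.1 hv) (sobSq_mono h v))

theorem sobSq_sub_le (k : ℕ) (v w : L2) : sobSq k (v - w) ≤ 2 * (sobSq k v + sobSq k w) := by
  refine le_trans (sqSum_mono fun ξ => ?_) (sqSum_add_le _ _)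
  rw [← mul_add]
  refine mul_le_mul_right ?_ _
  simp only [fourierCoeff_sub]
  exact enorm_sub_le

theorem MemSobolev.sub {k : ℕ} {v w : L2} (hv : MemSobolev k v) (hw : MemSobolev k w) :
    MemSobolev k (v - w) := by
  rw [memSobolev_iff] at *
  exact ne_top_of_le_ne_top (by finiteness) (sobSq_sub_le k v w)

theorem sob_modulus_vecCoeff_le {k : ℕ} {w : Fin 2 → L2} (hw : ∀ j, MemSobolev k (w j)) :
    sob k (modulus (vecCoeff w)) ≤ 2 * ENNReal.ofReal (sobolevNormVec k w ^ 2) := by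
  rw [sobolevNormVec, Real.sq_sqrt (by positivity), Fin.sum_univ_two,
    ENNReal.ofReal_add (sq_nonneg _) (sq_nonneg _), sobolevNorm_sq (hw 0), sobolevNorm_sq (hw 1)]
  refine le_trans (sqSum_mono fun ξ => ?_) (sqSum_add_le _ _)
  rw [← mul_add, modulus, Fin.sum_univ_two]
  rfl

/-! ### Energy identities in time -/

/-- As `g` is merely integrable, the chain rule for the square comes from absolute continuity of the
primitive. -/
theorem sq_sub_intervalIntegral {g : ℝ → ℝ} {t : ℝ} (hg : IntervalIntegrable g volume 0 t) (c : ℝ) :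
    (c - ∫ τ in (0 : ℝ)..t, g τ) ^ 2 =
      c ^ 2 - ∫ s in (0 : ℝ)..t, 2 * ((c - ∫ τ in (0 : ℝ)..s, g τ) * g s) := by
  set F : ℝ → ℝ := fun s => c - ∫ τ in (0 : ℝ)..s, g τ with hF
  have hac : AbsolutelyContinuousOnInterval F 0 t := by
    refine AbsolutelyContinuousOnInterval.sub ?_
      (hg.absolutelyContinuousOnInterval_intervalIntegral (c := 0) (by simp))
    exact (LipschitzWith.const c).lipschitzOnWith.absolutelyContinuousOnInterval
  have h1 := hac.integral_deriv_mul_eq_sub hac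
  have h2 : ∫ x in (0 : ℝ)..t, deriv F x * F x + F x * deriv F x =
      ∫ x in (0 : ℝ)..t, -(2 * (F x * g x)) := by
    refine intervalIntegral.integral_congr_ae ?_
    filter_upwards [hg.ae_hasDerivAt_integral] with x hx hx'
    have h3 : HasDerivAt F (0 - g x) x :=
      (hasDerivAt_const x c).sub (hx (Set.uIoc_subset_uIcc hx') 0 (by simp))
    rw [h3.deriv]
    ring
  rw [h2, intervalIntegral.integral_neg] at h1
  have h4 : F 0 = c := by simp [hF]
  have h5 : F t = c - ∫ τ in (0 : ℝ)..t, g τ := rfl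
  rw [h4, ← sq, ← sq] at h1
  rw [← h5]
  linarith

theorem continuousOn_sub_intervalIntegral {E : Type*} [NormedAddCommGroup E] [NormedSpace ℝ E]
    {g : ℝ → E} {t : ℝ} (hg : IntervalIntegrable g volume 0 t) (c : E) :
    ContinuousOn (fun s => c - ∫ τ in (0 : ℝ)..s, g τ) (Set.uIcc 0 t) :=
  continuousOn_const.sub
    (intervalIntegral.continuousOn_primitive_interval' hg (by simp))

theorem norm_sq_sub_intervalIntegral {g z : ℝ → ℂ} {T t : ℝ} (ht : t ∈ Set.Icc 0 T)
    (hg : IntervalIntegrable g volume 0 T) {c : ℂ}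
    (hz : ∀ s ∈ Set.Icc 0 T, z s = c - ∫ τ in (0 : ℝ)..s, g τ) :
    IntervalIntegrable (fun s => (conj (z s) * g s).re) volume 0 t ∧
    ‖z t‖ ^ 2 = ‖c‖ ^ 2 - ∫ s in (0 : ℝ)..t, 2 * (conj (z s) * g s).re := by
  have hsub : Set.uIcc 0 t ⊆ Set.uIcc 0 T := by
    rw [Set.uIcc_of_le ht.1, Set.uIcc_of_le (ht.1.trans ht.2)]
    exact Set.Icc_subset_Icc le_rfl ht.2
  have hgt := hg.mono_set hsub
  have hre : IntervalIntegrable (fun s => (g s).re) volume 0 t :=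
    ⟨hgt.1.re, hgt.2.re⟩
  have him : IntervalIntegrable (fun s => (g s).im) volume 0 t :=
    ⟨hgt.1.im, hgt.2.im⟩
  have e : ∀ s ∈ Set.uIcc 0 t, z s = c - ∫ τ in (0 : ℝ)..s, g τ := fun s hs => by
    refine hz s ?_
    have := hsub hs
    rwa [Set.uIcc_of_le (ht.1.trans ht.2)] at this
  have hgs : ∀ s ∈ Set.uIcc 0 t, IntervalIntegrable g volume 0 s := fun s hs =>
    hgt.mono_set (Set.uIcc_subset_uIcc_left hs)
  have ere : ∀ s ∈ Set.uIcc 0 t, (z s).re = c.re - ∫ τ in (0 : ℝ)..s, (g τ).re := fun s hs => by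
    rw [e s hs, Complex.sub_re]
    congr 1
    exact (Complex.reCLM.intervalIntegral_comp_comm (hgs s hs)).symm
  have eim : ∀ s ∈ Set.uIcc 0 t, (z s).im = c.im - ∫ τ in (0 : ℝ)..s, (g τ).im := fun s hs => by
    rw [e s hs, Complex.sub_im]
    congr 1
    exact (Complex.imCLM.intervalIntegral_comp_comm (hgs s hs)).symm
  have cre : ContinuousOn (fun s => (z s).re) (Set.uIcc 0 t) :=
    (continuousOn_sub_intervalIntegral hre c.re).congr ere
  have cim : ContinuousOn (fun s => (z s).im) (Set.uIcc 0 t) :=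
    (continuousOn_sub_intervalIntegral him c.im).congr eim
  have i1 := hre.continuousOn_mul cre
  have i2 := him.continuousOn_mul cim
  have hsplit : (fun s => (conj (z s) * g s).re) =
      fun s => (z s).re * (g s).re + (z s).im * (g s).im := by
    funext s
    simp [Complex.mul_re]
  refine ⟨hsplit ▸ i1.add i2, ?_⟩
  have s1 := sq_sub_intervalIntegral hre c.re
  have s2 := sq_sub_intervalIntegral him c.im
  have hmem : t ∈ Set.uIcc 0 t := Set.right_mem_uIcc
  rw [← ere t hmem] at s1
  rw [← eim t hmem] at s2
  have r1 : ∫ s in (0 : ℝ)..t, 2 * ((c.re - ∫ τ in (0 : ℝ)..s, (g τ).re) * (g s).re) =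
      ∫ s in (0 : ℝ)..t, 2 * ((z s).re * (g s).re) :=
    intervalIntegral.integral_congr fun s hs => by simp only [ere s hs]
  have r2 : ∫ s in (0 : ℝ)..t, 2 * ((c.im - ∫ τ in (0 : ℝ)..s, (g τ).im) * (g s).im) =
      ∫ s in (0 : ℝ)..t, 2 * ((z s).im * (g s).im) :=
    intervalIntegral.integral_congr fun s hs => by simp only [eim s hs]
  rw [r1] at s1
  rw [r2] at s2
  simp only [congrFun hsplit, mul_add]
  rw [intervalIntegral.integral_add (i1.const_mul 2) (i2.const_mul 2), ← Complex.normSq_eq_norm_sq,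
    ← Complex.normSq_eq_norm_sq, Complex.normSq_apply, Complex.normSq_apply]
  linarith

/-- The weighted energy inequality: a pointwise bound of the energy production in frequency space
can be integrated in time. -/
theorem sqSum_le_add_integral {T : ℝ} {v D : ℝ → L2} {v₀ : L2}
    (hD : IntervalIntegrable D volume 0 T)
    (hv : ∀ t ∈ Set.Icc 0 T, v t = v₀ - ∫ τ in (0 : ℝ)..t, D τ) (w : Freq → ℝ)
    {K : ℝ≥0∞} (hK : K ≠ ⊤)
    (hbound : ∀ τ ∈ Set.Icc 0 T, ∑' ξ, ‖(w ξ : ℂ) ^ 2 *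
      (conj (fourierCoeff (v τ) ξ) * fourierCoeff (D τ) ξ)‖ₑ ≤ K)
    {G : ℝ → ℝ} (hG : ContinuousOn G (Set.Icc 0 T))
    (hG0 : ∀ τ ∈ Set.Icc 0 T, 0 ≤ G τ)
    (hpair : ∀ τ ∈ Set.Icc 0 T, 2 * ‖(∑' ξ, (w ξ : ℂ) ^ 2 *
      (conj (fourierCoeff (v τ) ξ) * fourierCoeff (D τ) ξ)).re‖ₑ ≤ ENNReal.ofReal (G τ))
    {t : ℝ} (ht : t ∈ Set.Icc 0 T) :
    sqSum (fun ξ => ‖w ξ‖ₑ * ‖fourierCoeff (v t) ξ‖ₑ) ≤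
      sqSum (fun ξ => ‖w ξ‖ₑ * ‖fourierCoeff v₀ ξ‖ₑ) +
        ENNReal.ofReal (∫ τ in (0 : ℝ)..t, G τ) := by
  by_cases hfin : sqSum (fun ξ => ‖w ξ‖ₑ * ‖fourierCoeff v₀ ξ‖ₑ) = ⊤
  · rw [hfin, top_add]
    exact le_top
  have hsub : Set.Icc 0 t ⊆ Set.Icc 0 T := Set.Icc_subset_Icc le_rfl ht.2
  have hIoc : Set.uIoc 0 t ⊆ Set.Icc 0 T := by
    rw [Set.uIoc_of_le ht.1]
    exact Set.Ioc_subset_Icc_self.trans hsub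
  have hcoef : ∀ ξ, ∀ s ∈ Set.Icc 0 T, fourierCoeff (v s) ξ =
      fourierCoeff v₀ ξ - ∫ τ in (0 : ℝ)..s, fourierCoeff (D τ) ξ := fun ξ s hs => by
    rw [hv s hs, fourierCoeff_sub, ← fourierCLM_apply ξ (∫ τ in (0 : ℝ)..s, D τ)]
    congr 1
    refine ((fourierCLM ξ).intervalIntegral_comp_comm (hD.mono_set ?_)).symm
    rw [Set.uIcc_of_le hs.1, Set.uIcc_of_le (hs.1.trans hs.2)]
    exact Set.Icc_subset_Icc le_rfl hs.2
  have hmode : ∀ ξ, _ := fun ξ => norm_sq_sub_intervalIntegral ht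
    (g := fun τ => fourierCoeff (D τ) ξ) (z := fun τ => fourierCoeff (v τ) ξ)
    ⟨(fourierCLM ξ).integrable_comp hD.1, (fourierCLM ξ).integrable_comp hD.2⟩ (hcoef ξ)
  set h : Freq → ℝ → ℂ := fun ξ τ => (w ξ : ℂ) ^ 2 *
      (conj (fourierCoeff (v τ) ξ) * fourierCoeff (D τ) ξ) with hh
  have hre : ∀ ξ τ, (h ξ τ).re =
      w ξ ^ 2 * (conj (fourierCoeff (v τ) ξ) * fourierCoeff (D τ) ξ).re := fun ξ τ => by
    simp only [hh]
    rw [← Complex.ofReal_pow, Complex.re_ofReal_mul]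
  have hint : ∀ ξ, IntervalIntegrable (fun τ => (h ξ τ).re) volume 0 t := fun ξ => by
    simp only [hre]
    exact (hmode ξ).1.const_mul _
  have hsum : ∀ τ ∈ Set.Icc 0 T, Summable fun ξ => h ξ τ := fun τ hτ =>
    summable_of_tsum_enorm_ne_top (ne_top_of_le_ne_top hK (hbound τ hτ))
  -- Partial sums over finite sets of frequencies are dominated by the constant `K`, so the exact
  -- finite balances behind `hfinite` pass to the whole lattice.
  have hlim : Tendsto (fun s : Finset Freq => ∫ τ in (0 : ℝ)..t, ∑ ξ ∈ s, (h ξ τ).re) atTop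
      (𝓝 (∫ τ in (0 : ℝ)..t, (∑' ξ, h ξ τ).re)) := by
    refine intervalIntegral.tendsto_integral_filter_of_dominated_convergence (fun _ => K.toReal)
      (Eventually.of_forall fun s => ?_) (Eventually.of_forall fun s => ?_)
      intervalIntegrable_const (Eventually.of_forall fun τ hτ => ?_)
    · exact Finset.aestronglyMeasurable_fun_sum s fun ξ _ =>
        (intervalIntegrable_iff.1 (hint ξ)).aestronglyMeasurable
    · refine Eventually.of_forall fun τ hτ => ?_
      have hτ' := hIoc hτ
      rw [← Complex.re_sum]
      refine (Complex.abs_re_le_norm _).trans ?_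
      rw [← toReal_enorm]
      refine ENNReal.toReal_mono hK ((enorm_sum_le _ _).trans ?_)
      exact (ENNReal.sum_le_tsum s).trans (hbound τ hτ')
    · have := (hsum τ (hIoc hτ)).hasSum
      exact (Complex.reCLM.hasSum this)
  have hI : -(2 * ∫ τ in (0 : ℝ)..t, (∑' ξ, h ξ τ).re) ≤ ∫ τ in (0 : ℝ)..t, G τ := by
    have h1 : ‖∫ τ in (0 : ℝ)..t, 2 * (∑' ξ, h ξ τ).re‖ ≤ ∫ τ in (0 : ℝ)..t, G τ := by
      refine intervalIntegral.norm_integral_le_of_norm_le ht.1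
        (Eventually.of_forall fun τ hτ => ?_) ?_
      · rw [← Set.uIoc_of_le ht.1] at hτ
        have := hpair τ (hIoc hτ)
        rw [← ofReal_norm, ← ENNReal.ofReal_ofNat 2, ← ENNReal.ofReal_mul zero_le_two] at this
        rw [norm_mul, Real.norm_of_nonneg zero_le_two]
        exact (ENNReal.ofReal_le_ofReal_iff (hG0 τ (hIoc hτ))).1 this
      · refine ContinuousOn.intervalIntegrable ?_
        rw [Set.uIcc_of_le ht.1]
        exact hG.mono hsub
    rw [intervalIntegral.integral_const_mul] at h1
    exact (neg_le_abs _).trans h1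
  set A₀ := (sqSum (fun ξ => ‖w ξ‖ₑ * ‖fourierCoeff v₀ ξ‖ₑ)).toReal with hA₀
  have hterm : ∀ (a : Freq → ℂ) (ξ : Freq),
      (‖w ξ‖ₑ * ‖a ξ‖ₑ) ^ 2 = ENNReal.ofReal (w ξ ^ 2 * ‖a ξ‖ ^ 2) := fun a ξ => by
    rw [← ofReal_norm, ← ofReal_norm, ← ENNReal.ofReal_mul (norm_nonneg _),
      ← ENNReal.ofReal_pow (by positivity), mul_pow, Real.norm_eq_abs, sq_abs]
  have hfinite : ∀ s : Finset Freq, ∑ ξ ∈ s, (‖w ξ‖ₑ * ‖fourierCoeff (v t) ξ‖ₑ) ^ 2 ≤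
      ENNReal.ofReal (A₀ - 2 * ∫ τ in (0 : ℝ)..t, ∑ ξ ∈ s, (h ξ τ).re) := fun s => by
    simp only [hterm]
    rw [← ENNReal.ofReal_sum_of_nonneg fun ξ _ => by positivity]
    refine ENNReal.ofReal_le_ofReal ?_
    have h1 : ∑ ξ ∈ s, w ξ ^ 2 * ‖fourierCoeff v₀ ξ‖ ^ 2 ≤ A₀ := by
      rw [hA₀, ← ENNReal.ofReal_le_iff_le_toReal hfin,
        ENNReal.ofReal_sum_of_nonneg fun ξ _ => by positivity]
      simp only [← hterm]
      exact ENNReal.sum_le_tsum s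
    have h2 : ∑ ξ ∈ s, w ξ ^ 2 * ‖fourierCoeff (v t) ξ‖ ^ 2 =
        ∑ ξ ∈ s, w ξ ^ 2 * ‖fourierCoeff v₀ ξ‖ ^ 2 -
          2 * ∫ τ in (0 : ℝ)..t, ∑ ξ ∈ s, (h ξ τ).re := by
      rw [intervalIntegral.integral_finsetSum fun ξ _ => hint ξ, Finset.mul_sum,
        ← Finset.sum_sub_distrib]
      refine Finset.sum_congr rfl fun ξ _ => ?_
      rw [(hmode ξ).2]
      simp only [hre, intervalIntegral.integral_const_mul]
      ring
    linarith
  have hlim2 : Tendsto (fun s : Finset Freq =>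
      ENNReal.ofReal (A₀ - 2 * ∫ τ in (0 : ℝ)..t, ∑ ξ ∈ s, (h ξ τ).re)) atTop
      (𝓝 (ENNReal.ofReal (A₀ - 2 * ∫ τ in (0 : ℝ)..t, (∑' ξ, h ξ τ).re))) :=
    ENNReal.tendsto_ofReal (tendsto_const_nhds.sub (hlim.const_mul 2))
  have hle := le_of_tendsto_of_tendsto' ENNReal.summable.hasSum hlim2 hfinite
  refine hle.trans ?_
  calc ENNReal.ofReal (A₀ - 2 * ∫ τ in (0 : ℝ)..t, (∑' ξ, h ξ τ).re)
      ≤ ENNReal.ofReal (A₀ + ∫ τ in (0 : ℝ)..t, G τ) := ENNReal.ofReal_le_ofReal (by linarith)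
    _ ≤ ENNReal.ofReal A₀ + ENNReal.ofReal (∫ τ in (0 : ℝ)..t, G τ) := ENNReal.ofReal_add_le
    _ = _ := by rw [hA₀, ENNReal.ofReal_toReal hfin]

/-! ### Continuity of the norms in time -/

/-- The weighted Fourier coefficients as an element of `ℓ²`. -/
def weightedCoeff (k : ℕ) (v : L2) (h : MemSobolev k v) : lp (fun _ : Freq => ℂ) 2 :=
  ⟨fun ξ => (lam ξ : ℂ) ^ k * fourierCoeff v ξ, by
    refine memℓp_gen ?_
    refine h.congr fun ξ => ?_
    rw [sobolevTerm, ← lam_sq, norm_mul, norm_pow, Complex.norm_real,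
      Real.norm_of_nonneg (lam_pos ξ).le, ENNReal.toReal_ofNat, Real.rpow_two]
    ring⟩

/-- Transfers the triangle inequality of `ℓ²` to `sobolevNorm`. -/
theorem norm_weightedCoeff (k : ℕ) (v : L2) (h : MemSobolev k v) :
    ‖weightedCoeff k v h‖ = sobolevNorm k v := by
  rw [lp.norm_eq_tsum_rpow (by simp), sobolevNorm, Real.sqrt_eq_rpow, ENNReal.toReal_ofNat]
  congr 1
  refine tsum_congr fun ξ => ?_
  simp only [weightedCoeff]
  rw [sobolevTerm, ← lam_sq, norm_mul, norm_pow, Complex.norm_real,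
    Real.norm_of_nonneg (lam_pos ξ).le, Real.rpow_two]
  ring

theorem abs_sobolevNorm_sub_le {k : ℕ} {v w : L2} (hv : MemSobolev k v) (hw : MemSobolev k w) :
    |sobolevNorm k v - sobolevNorm k w| ≤ sobolevNorm k (v - w) := by
  rw [← norm_weightedCoeff k v hv, ← norm_weightedCoeff k w hw,
    ← norm_weightedCoeff k (v - w) (hv.sub hw)]
  refine (abs_norm_sub_norm_le _ _).trans_eq ?_
  congr 1
  ext ξ
  simp only [weightedCoeff, lp.coeFn_sub, Pi.sub_apply, fourierCoeff_sub]
  ring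

theorem ContinuousInSobolev.continuousOn {k : ℕ} {T : ℝ} {v : ℝ → L2}
    (h : ContinuousInSobolev k T v) :
    ContinuousOn (fun t => sobolevNorm k (v t)) (Set.Icc 0 T) := by
  intro t ht
  refine tendsto_iff_dist_tendsto_zero.2 ?_
  refine squeeze_zero' (Eventually.of_forall fun s => dist_nonneg) ?_ (h.2 t ht)
  filter_upwards [self_mem_nhdsWithin] with s hs
  rw [Real.dist_eq]
  exact abs_sobolevNorm_sub_le (h.1 s hs) (h.1 t ht)

theorem sobolevNorm_nonneg (k : ℕ) (v : L2) : 0 ≤ sobolevNorm k v := Real.sqrt_nonneg _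

theorem sobolevNorm_mono {k l : ℕ} (hkl : k ≤ l) {v : L2} (h : MemSobolev l v) :
    sobolevNorm k v ≤ sobolevNorm l v := by
  refine le_of_sq_le_sq ?_ (sobolevNorm_nonneg l v)
  rw [← ENNReal.ofReal_le_ofReal_iff (sq_nonneg _), sobolevNorm_sq h, sobolevNorm_sq (h.mono hkl)]
  exact sobSq_mono hkl v

theorem sobolevNorm_add_le {k : ℕ} {v w z : L2} (hv : MemSobolev k v) (hw : MemSobolev k w)
    (hz : z = v - w) : sobolevNorm k z ≤ sobolevNorm k v + sobolevNorm k w := by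
  subst hz
  rw [← norm_weightedCoeff k v hv, ← norm_weightedCoeff k w hw,
    ← norm_weightedCoeff k (v - w) (hv.sub hw)]
  refine le_trans (le_of_eq ?_) (norm_sub_le _ _)
  congr 1
  ext ξ
  simp only [weightedCoeff, lp.coeFn_sub, Pi.sub_apply, fourierCoeff_sub]
  ring

theorem ContinuousInSobolev.mono {k l : ℕ} {S T : ℝ} {v : ℝ → L2}
    (h : ContinuousInSobolev l T v) (hkl : k ≤ l) (hST : S ≤ T) : ContinuousInSobolev k S v := by
  have hsub : Set.Icc 0 S ⊆ Set.Icc 0 T := Set.Icc_subset_Icc le_rfl hST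
  refine ⟨fun t ht => (h.1 t (hsub ht)).mono hkl, fun t ht => ?_⟩
  refine squeeze_zero' (Eventually.of_forall fun s => sobolevNorm_nonneg _ _) ?_
    ((h.2 t (hsub ht)).mono_left (nhdsWithin_mono t hsub))
  filter_upwards [self_mem_nhdsWithin] with s hs
  exact sobolevNorm_mono hkl ((h.1 s (hsub hs)).sub (h.1 t (hsub ht)))

theorem ContinuousInSobolev.sub {k : ℕ} {T : ℝ} {v w : ℝ → L2}
    (hv : ContinuousInSobolev k T v) (hw : ContinuousInSobolev k T w) :
    ContinuousInSobolev k T fun t => v t - w t := by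
  refine ⟨fun t ht => (hv.1 t ht).sub (hw.1 t ht), fun t ht => ?_⟩
  refine squeeze_zero' (Eventually.of_forall fun s => sobolevNorm_nonneg _ _) ?_
    (by simpa using (hv.2 t ht).add (hw.2 t ht))
  filter_upwards [self_mem_nhdsWithin] with s hs
  exact sobolevNorm_add_le ((hv.1 s hs).sub (hv.1 t ht)) ((hw.1 s hs).sub (hw.1 t ht))
    (by abel)

/-! ### Grönwall inequalities in integral form -/

theorem le_mul_exp_of_le_add_integral {T K y₀ : ℝ} (hK : 0 ≤ K) {y : ℝ → ℝ}
    (hy : ContinuousOn y (Set.Icc 0 T))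
    (h : ∀ t ∈ Set.Icc 0 T, y t ≤ y₀ + ∫ τ in (0 : ℝ)..t, K * y τ) :
    ∀ t ∈ Set.Icc 0 T, y t ≤ y₀ * Real.exp (K * t) := by
  intro t ht
  have hT : 0 ≤ T := ht.1.trans ht.2
  -- Extending `y` continuously beyond the interval makes its primitive differentiable everywhere;
  -- the differential Grönwall inequality is applied to that primitive, since `y` itself is only
  -- continuous.
  set Y : ℝ → ℝ := Set.IccExtend hT ((Set.Icc 0 T).domRestrict y) with hYdef
  have hYc : Continuous Y := Continuous.Icc_extend' hy.domRestrict
  have hYy : ∀ s ∈ Set.Icc 0 T, Y s = y s := fun s hs => Set.IccExtend_of_mem hT _ hs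
  have hint : ∀ s ∈ Set.Icc 0 T, ∫ τ in (0 : ℝ)..s, K * y τ = K * ∫ τ in (0 : ℝ)..s, Y τ := by
    intro s hs
    rw [intervalIntegral.integral_const_mul]
    congr 1
    refine intervalIntegral.integral_congr fun τ hτ => ?_
    rw [Set.uIcc_of_le hs.1] at hτ
    exact (hYy τ ⟨hτ.1, hτ.2.trans hs.2⟩).symm
  have hder : ∀ s, HasDerivAt (fun s => ∫ τ in (0 : ℝ)..s, Y τ) (Y s) s := fun s =>
    intervalIntegral.integral_hasDerivAt_right (hYc.intervalIntegrable _ _)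
      (hYc.stronglyMeasurableAtFilter _ _) hYc.continuousAt
  have hz := le_gronwallBound_of_liminf_deriv_right_le (f := fun s => ∫ τ in (0 : ℝ)..s, Y τ)
    (f' := Y) (δ := 0) (K := K) (ε := y₀) (a := 0) (b := T)
    (fun s _ => (hder s).continuousAt.continuousWithinAt)
    (fun s _ r hr => (hder s).hasDerivWithinAt.liminf_right_slope_le hr) (by simp)
    (fun s hs => by
      have hs' := Set.Ico_subset_Icc_self hs
      rw [hYy s hs']
      linarith [h s hs', hint s hs']) t ht
  have h1 := h t ht
  rw [hint t ht] at h1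
  rcases hK.eq_or_lt with rfl | hK'
  · simpa using h1
  · rw [gronwallBound_of_K_ne_0 hK'.ne'] at hz
    simp only [sub_zero, zero_mul, zero_add] at hz
    have h2 := mul_le_mul_of_nonneg_left hz hK
    have h3 : K * (y₀ / K * (Real.exp (K * t) - 1)) = y₀ * (Real.exp (K * t) - 1) := by
      field_simp
    linarith

/-- A continuity argument: if the nondecreasing majorant `Z` reached `2 y₀` at time `s`, then `y ≤ 2
y₀` up to `s`, so `2 y₀ ≤ y₀ + 4 C y₀² s < 2 y₀`. -/
theorem le_two_mul_of_le_add_integral_sq {T C y₀ : ℝ} (hC : 0 < C) (hy₀ : 0 < y₀)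
    (hT : 4 * C * y₀ * T < 1) {y : ℝ → ℝ} (hy : ContinuousOn y (Set.Icc 0 T))
    (hpos : ∀ t ∈ Set.Icc 0 T, 0 ≤ y t)
    (h : ∀ t ∈ Set.Icc 0 T, y t ≤ y₀ + ∫ τ in (0 : ℝ)..t, C * y τ ^ 2) :
    ∀ t ∈ Set.Icc 0 T, y t ≤ 2 * y₀ := by
  intro t ht
  by_contra! hlt
  have hT0 : 0 ≤ T := ht.1.trans ht.2
  set Z : ℝ → ℝ := fun s => y₀ + ∫ τ in (0 : ℝ)..s, C * y τ ^ 2 with hZ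
  have hcont : ContinuousOn (fun τ => C * y τ ^ 2) (Set.Icc 0 T) :=
    continuousOn_const.mul (hy.pow 2)
  have hii : ∀ a ∈ Set.Icc 0 T, ∀ b ∈ Set.Icc 0 T,
      IntervalIntegrable (fun τ => C * y τ ^ 2) volume a b := fun a ha b hb =>
    (hcont.mono (Set.uIcc_subset_Icc ha hb)).intervalIntegrable
  have h0 : (0 : ℝ) ∈ Set.Icc 0 T := ⟨le_rfl, hT0⟩
  have hZc : ContinuousOn Z (Set.Icc 0 T) := by
    have := intervalIntegral.continuousOn_primitive_interval' (hii 0 h0 T ⟨hT0, le_rfl⟩)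
      (a := 0) (by simp)
    rw [Set.uIcc_of_le hT0] at this
    exact continuousOn_const.add this
  have hmono : ∀ a ∈ Set.Icc 0 T, ∀ b ∈ Set.Icc 0 T, a ≤ b → Z a ≤ Z b := fun a ha b hb hab => by
    have e := intervalIntegral.integral_add_adjacent_intervals (hii 0 h0 a ha) (hii a ha b hb)
    have p : 0 ≤ ∫ τ in a..b, C * y τ ^ 2 :=
      intervalIntegral.integral_nonneg hab fun τ _ => by positivity
    simp only [hZ]
    linarith
  have hsub : Set.Icc 0 t ⊆ Set.Icc 0 T := Set.Icc_subset_Icc le_rfl ht.2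
  have hZ0 : Z 0 = y₀ := by simp [hZ]
  obtain ⟨s, hs, hs2⟩ := intermediate_value_Icc ht.1 (hZc.mono hsub)
    (show 2 * y₀ ∈ Set.Icc (Z 0) (Z t) from ⟨by linarith, hlt.le.trans (h t ht)⟩)
  have hsT := hsub hs
  have hle : ∫ τ in (0 : ℝ)..s, C * y τ ^ 2 ≤ ∫ τ in (0 : ℝ)..s, C * (2 * y₀) ^ 2 := by
    refine intervalIntegral.integral_mono_on hs.1 (hii 0 h0 s hsT) intervalIntegrable_const
      fun τ hτ => ?_
    have hτ' : τ ∈ Set.Icc 0 T := ⟨hτ.1, hτ.2.trans hsT.2⟩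
    have := hpos τ hτ'
    gcongr
    exact (h τ hτ').trans ((hmono τ hτ' s hsT hτ.2).trans_eq hs2)
  rw [intervalIntegral.integral_const, smul_eq_mul, sub_zero] at hle
  have h3 : y₀ + ∫ τ in (0 : ℝ)..s, C * y τ ^ 2 = 2 * y₀ := hs2
  have h4 : s * (C * (2 * y₀) ^ 2) ≤ T * (C * (2 * y₀) ^ 2) := by
    gcongr
    exact hsT.2
  nlinarith

/-! ### The energy estimate for a transport equation with forcing -/

theorem sqSum_weight_le {w : Freq → ℝ} {N : ℝ≥0∞} {m : ℕ} (h : ∀ ξ, ‖w ξ‖ₑ ≤ N * elam ξ ^ m)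
    (f : Freq → ℝ≥0∞) : sqSum (fun ξ => ‖w ξ‖ₑ * f ξ) ≤ N ^ 2 * sob m f := by
  rw [sob, ← sqSum_const_mul]
  refine sqSum_mono fun ξ => ?_
  rw [← mul_assoc]
  exact mul_le_mul_left (h ξ) _

theorem two_mul_tsum_enorm_weight_le (w : Freq → ℝ) (a D : Freq → ℂ) :
    2 * ∑' ξ, ‖(w ξ : ℂ) ^ 2 * (conj (a ξ) * D ξ)‖ₑ ≤
      sqSum (fun ξ => ‖w ξ‖ₑ * ‖a ξ‖ₑ) + sqSum (fun ξ => ‖w ξ‖ₑ * ‖D ξ‖ₑ) := by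
  rw [sqSum, sqSum, ← ENNReal.tsum_add, ← ENNReal.tsum_mul_left]
  refine ENNReal.tsum_le_tsum fun ξ => ?_
  refine le_trans (le_of_eq ?_) (two_mul_mul_le_sq_add_sq _ _)
  simp only [enorm_mul, enorm_pow, RCLike.enorm_conj, enorm_complex_ofReal]
  ring

theorem sob_add_le (k : ℕ) (a b : Freq → ℂ) : sob k (fun ξ => ‖a ξ + b ξ‖ₑ) ≤
    2 * (sob k (fun ξ => ‖a ξ‖ₑ) + sob k (fun ξ => ‖b ξ‖ₑ)) := by
  refine le_trans (sqSum_mono fun ξ => ?_) (sqSum_add_le _ _)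
  rw [← mul_add]
  exact mul_le_mul_right (enorm_add_le _ _) _

theorem sob_divCoeff_le {k : ℕ} (hk : k ≤ 1) {u : Fin 2 → L2} (hu : IsSolenoidal (vecCoeff u))
    (q : L2) : sob (k + 1) (fun ξ => ‖divCoeff u q ξ‖ₑ) ≤
      784 * embConst * sob 2 (modulus (vecCoeff u)) * sobSq (k + 2) q :=
  sob_transport_le hk fun ξ => hasSum_divCoeff hu q ξ

/-- `M` only secures absolute and dominated convergence and is absent from the conclusion; `G`
carries the quantitative bound. The 2 in `hbound` is 1 from the commutator and 1 from pairing with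
`R`, both through `2xy ≤ x² + y²`. -/
theorem IsWeight.energy_le {k l : ℕ} {w : Freq → ℝ} (hw : IsWeight k l w) (hk : k ≤ 1) {T : ℝ}
    {v D : ℝ → L2} {v₀ : L2} (hD : IntervalIntegrable D volume 0 T)
    (hv : ∀ t ∈ Set.Icc 0 T, v t = v₀ - ∫ τ in (0 : ℝ)..t, D τ)
    {U : ℝ → Fin 2 → L2} {R : ℝ → Freq → ℂ}
    (hU : ∀ t ∈ Set.Icc 0 T, IsSolenoidal (vecCoeff (U t)))
    (hDR : ∀ t ∈ Set.Icc 0 T, ∀ ξ, fourierCoeff (D t) ξ = divCoeff (U t) (v t) ξ + R t ξ)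
    {M : ℝ≥0∞} (hM : M ≠ ⊤) (hvM : ∀ t ∈ Set.Icc 0 T, sobSq (k + 2) (v t) ≤ M)
    (hUM : ∀ t ∈ Set.Icc 0 T, sob 2 (modulus (vecCoeff (U t))) ≤ M)
    (hRM : ∀ t ∈ Set.Icc 0 T, sob (k + 1) (fun ξ => ‖R t ξ‖ₑ) ≤ M)
    {G : ℝ → ℝ} (hG : ContinuousOn G (Set.Icc 0 T)) (hG0 : ∀ t ∈ Set.Icc 0 T, 0 ≤ G t)
    (hbound : ∀ t ∈ Set.Icc 0 T,
      (2 + 19600 * embConst * sob 3 (modulus (vecCoeff (U t)))) * sobSq l (v t) +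
        sob l (fun ξ => ‖R t ξ‖ₑ) ≤ ENNReal.ofReal (G t))
    {t : ℝ} (ht : t ∈ Set.Icc 0 T) :
    sqSum (fun ξ => ‖w ξ‖ₑ * ‖fourierCoeff (v t) ξ‖ₑ) ≤
      sobSq l v₀ + ENNReal.ofReal (∫ τ in (0 : ℝ)..t, G τ) := by
  obtain ⟨N, hN, hwN⟩ := hw.bound
  have hE := embConst_ne_top
  have hle : ∀ f : Freq → ℝ≥0∞, sqSum (fun ξ => ‖w ξ‖ₑ * f ξ) ≤ sob l f := fun f =>
    sqSum_mono fun ξ => mul_le_mul_left (hw.le ξ) _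
  have hdiv : ∀ τ ∈ Set.Icc 0 T,
      sob (k + 1) (fun ξ => ‖divCoeff (U τ) (v τ) ξ‖ₑ) ≤ 784 * embConst * M * M := fun τ hτ => by
    refine (sob_divCoeff_le hk (hU τ hτ) (v τ)).trans ?_
    gcongr
    · exact hUM τ hτ
    · exact hvM τ hτ
  have hv1 : ∀ τ ∈ Set.Icc 0 T, sobSq (k + 1) (v τ) ≤ M := fun τ hτ =>
    (sobSq_mono (by lia) _).trans (hvM τ hτ)
  refine (sqSum_le_add_integral hD hv w
    (K := N ^ 2 * M + N ^ 2 * (2 * (784 * embConst * M * M + M)))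
    (by finiteness) (fun τ hτ => ?_) hG hG0 (fun τ hτ => ?_) ht).trans
    (add_le_add_left (hle _) _)
  · refine le_trans ?_ ((two_mul_tsum_enorm_weight_le w (fourierCoeff (v τ))
      (fourierCoeff (D τ))).trans ?_)
    · rw [two_mul]
      exact le_self_add
    · refine add_le_add ((sqSum_weight_le hwN _).trans (mul_le_mul_right (hv1 τ hτ) _)) ?_
      refine (sqSum_weight_le hwN _).trans (mul_le_mul_right ?_ _)
      simp only [hDR τ hτ]
      refine (sob_add_le _ _ _).trans ?_
      gcongr
      · exact hdiv τ hτ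
      · exact hRM τ hτ
  · have hfin : ∀ D' : Freq → ℂ, sob (k + 1) (fun ξ => ‖D' ξ‖ₑ) ≠ ⊤ →
        Summable fun ξ => (w ξ : ℂ) ^ 2 * (conj (fourierCoeff (v τ) ξ) * D' ξ) := fun D' hD' => by
      refine summable_of_tsum_enorm_ne_top (ne_top_of_le_ne_top ?_
        (le_trans ?_ ((two_mul_tsum_enorm_weight_le w (fourierCoeff (v τ)) D').trans
          (add_le_add (sqSum_weight_le hwN _) (sqSum_weight_le hwN _)))))
      · have := ne_top_of_le_ne_top hM (hv1 τ hτ)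
        rw [sobSq] at this
        finiteness
      · rw [two_mul]
        exact le_self_add
    have s1 := hfin (divCoeff (U τ) (v τ))
      (ne_top_of_le_ne_top (by finiteness) (hdiv τ hτ))
    have s2 := hfin (R τ) (ne_top_of_le_ne_top hM (hRM τ hτ))
    simp only [hDR τ hτ, mul_add]
    rw [s1.tsum_add s2, Complex.add_re]
    have p1 := hw.transport_le hk (hU τ hτ) (ne_top_of_le_ne_top hM (hUM τ hτ))
      (ne_top_of_le_ne_top hM (hvM τ hτ)) (fun ξ => hasSum_divCoeff (hU τ hτ) (v τ) ξ)
    have p2 : 2 * ‖(∑' ξ, (w ξ : ℂ) ^ 2 * (conj (fourierCoeff (v τ) ξ) * R τ ξ)).re‖ₑ ≤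
        sobSq l (v τ) + sob l (fun ξ => ‖R τ ξ‖ₑ) := by
      refine le_trans ?_ ((two_mul_tsum_enorm_weight_le w (fourierCoeff (v τ)) (R τ)).trans
        (add_le_add (hle _) (hle _)))
      gcongr
      refine le_trans ?_ enorm_tsum_le_tsum_enorm
      rw [← ofReal_norm, ← ofReal_norm]
      exact ENNReal.ofReal_le_ofReal (Complex.abs_re_le_norm _)
    refine le_trans ?_ (hbound τ hτ)
    calc _ ≤ 2 * (‖(∑' ξ, (w ξ : ℂ) ^ 2 *
            (conj (fourierCoeff (v τ) ξ) * divCoeff (U τ) (v τ) ξ)).re‖ₑ +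
          ‖(∑' ξ, (w ξ : ℂ) ^ 2 * (conj (fourierCoeff (v τ) ξ) * R τ ξ)).re‖ₑ) := by
          gcongr
          exact enorm_add_le _ _
      _ ≤ (1 + 19600 * embConst * sob 3 (modulus (vecCoeff (U τ)))) * sobSq l (v τ) +
          (sobSq l (v τ) + sob l (fun ξ => ‖R τ ξ‖ₑ)) := by
          rw [mul_add]
          exact add_le_add p1 p2
      _ = _ := by ring

/-! ### Strong solutions in frequency space -/

theorem divCoeff_sub_right {u : Fin 2 → L2} (hu : IsSolenoidal (vecCoeff u)) (p q : L2) (ξ : Freq) :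
    divCoeff u (p - q) ξ = divCoeff u p ξ - divCoeff u q ξ := by
  refine (hasSum_divCoeff hu (p - q) ξ).unique ?_
  refine ((hasSum_divCoeff hu p ξ).sub (hasSum_divCoeff hu q ξ)).congr_fun fun η => ?_
  rw [fourierCoeff_sub, mul_sub]

/-- The velocity and the time derivatives of a strong solution, in frequency space. -/
structure IsFrequencySolution (uh : Fin 2 → L2) (f b₀ ω₀ : L2) (b ω : ℝ → L2) (T : ℝ)
    (u : ℝ → Fin 2 → L2) (Db Dω : ℝ → L2) : Prop where
  velocity : ∀ t ∈ Set.Icc 0 T, IsVelocity f (ω t) (u t)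
  coeff_Db : ∀ t ∈ Set.Icc 0 T, ∀ ξ, fourierCoeff (Db t) ξ = divCoeff (u t) (b t) ξ
  coeff_Dω : ∀ t ∈ Set.Icc 0 T, ∀ ξ,
    fourierCoeff (Dω t) ξ = divCoeff (u t) (ω t - b t) ξ + divCoeff uh (b t) ξ
  integrable_Db : IntervalIntegrable Db volume 0 T
  integrable_Dω : IntervalIntegrable Dω volume 0 T
  eq_b : ∀ t ∈ Set.Icc 0 T, b t = b₀ - ∫ τ in (0 : ℝ)..t, Db τ
  eq_ω : ∀ t ∈ Set.Icc 0 T, ω t = ω₀ - ∫ τ in (0 : ℝ)..t, Dω τ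

section

variable {uh : Fin 2 → L2} {f b₀ ω₀ : L2} {b ω : ℝ → L2} {T : ℝ}

theorem IsStrongSolution.exists_isFrequencySolution (h : IsStrongSolution uh f b₀ ω₀ b ω T) :
    ∃ u Db Dω, IsFrequencySolution uh f b₀ ω₀ b ω T u Db Dω := by
  obtain ⟨u, Db, Dω, h1, h2, h3, h4⟩ := h.equations
  exact ⟨u, Db, Dω, fun t ht => (h1 t ht).1,
    fun t ht ξ => (h1 t ht).2.1.fourierCoeff_eq_divCoeff ξ,
    fun t ht ξ => (h1 t ht).2.2.fourierCoeff_eq_divCoeff_add ξ, h2, h3,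
    fun t ht => (h4 t ht).1, fun t ht => (h4 t ht).2⟩

theorem IsStrongSolution.mono (h : IsStrongSolution uh f b₀ ω₀ b ω T) {S : ℝ} (hS : 0 < S)
    (hST : S ≤ T) : IsStrongSolution uh f b₀ ω₀ b ω S := by
  have hsub : Set.Icc 0 S ⊆ Set.Icc 0 T := Set.Icc_subset_Icc le_rfl hST
  have hsub' : Set.uIcc 0 S ⊆ Set.uIcc 0 T := by
    rwa [Set.uIcc_of_le hS.le, Set.uIcc_of_le (hS.le.trans hST)]
  obtain ⟨u, Db, Dω, h1, h2, h3, h4⟩ := h.equations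
  exact ⟨hS, h.continuous_b.mono le_rfl hST, h.continuous_ω.mono le_rfl hST, u, Db, Dω,
    fun t ht => h1 t (hsub ht), h2.mono_set hsub', h3.mono_set hsub', fun t ht => h4 t (hsub ht)⟩

end

theorem IsVelocity.sob_modulus_le {f ω : L2} {u : Fin 2 → L2} (h : IsVelocity f ω u) :
    sob 3 (modulus (vecCoeff u)) ≤ 8 * (sobSq 2 ω + sobSq 2 f) := by
  calc sob 3 (modulus (vecCoeff u)) ≤ 4 * sobSq 2 (ω - f) := h.isBiotSavart.sob_modulus_le 2
    _ ≤ 4 * (2 * (sobSq 2 ω + sobSq 2 f)) := by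
      gcongr
      exact sobSq_sub_le 2 ω f
    _ = _ := by ring

theorem ContinuousInSobolev.exists_sobSq_le {k : ℕ} {T : ℝ} {v : ℝ → L2}
    (h : ContinuousInSobolev k T v) :
    ∃ M : ℝ≥0∞, M ≠ ⊤ ∧ ∀ t ∈ Set.Icc 0 T, sobSq k (v t) ≤ M := by
  obtain ⟨C, hC⟩ := isCompact_Icc.exists_bound_of_continuousOn (h.continuousOn.pow 2)
  refine ⟨ENNReal.ofReal C, ENNReal.ofReal_ne_top, fun t ht => ?_⟩
  rw [← sobolevNorm_sq (h.1 t ht)]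
  exact ENNReal.ofReal_le_ofReal ((le_abs_self _).trans (hC t ht))

theorem sobSq_le_ofReal {k : ℕ} {v : L2} (h : MemSobolev k v) {B : ℝ} (hB : sobolevNorm k v ≤ B) :
    sobSq k v ≤ ENNReal.ofReal (B ^ 2) := by
  rw [← sobolevNorm_sq h]
  exact ENNReal.ofReal_le_ofReal (pow_le_pow_left₀ (sobolevNorm_nonneg k v) hB 2)

theorem sobolevNorm_sq_le_add {k : ℕ} {v v₀ : L2} (hv : MemSobolev k v) (hv₀ : MemSobolev k v₀)
    {I : ℝ} (hI : 0 ≤ I) (h : sobSq k v ≤ sobSq k v₀ + ENNReal.ofReal I) :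
    sobolevNorm k v ^ 2 ≤ sobolevNorm k v₀ ^ 2 + I := by
  rw [← sobolevNorm_sq hv, ← sobolevNorm_sq hv₀, ← ENNReal.ofReal_add (sq_nonneg _) hI,
    ENNReal.ofReal_le_ofReal_iff (by positivity)] at h
  exact h

theorem sqSum_lam_pow (k : ℕ) (v : L2) :
    sqSum (fun ξ => ‖lam ξ ^ k‖ₑ * ‖fourierCoeff v ξ‖ₑ) = sobSq k v := by
  refine tsum_congr fun ξ => ?_
  simp only [enorm_pow, elam, ← ofReal_norm (lam ξ), Real.norm_of_nonneg (lam_pos ξ).le]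

/-! ### Continuous dependence on the data -/

/-- The exponential rate of the estimate for differences. -/
def diffRate (B₁ W₁ W₂ U F : ℝ) : ℝ≥0∞ :=
  -- The factor is a round number large enough to absorb every numerical constant below. No bound on
  -- `b₂` appears, because only the first solution is hit by the difference of velocities.
  2 + 1000000 * embConst * (ENNReal.ofReal (B₁ ^ 2) + ENNReal.ofReal (W₁ ^ 2) +
    ENNReal.ofReal (W₂ ^ 2) + ENNReal.ofReal (U ^ 2) + ENNReal.ofReal (F ^ 2))

theorem diffRate_ne_top (B₁ W₁ W₂ U F : ℝ) : diffRate B₁ W₁ W₂ U F ≠ ⊤ := by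
  have := embConst_ne_top
  unfold diffRate
  finiteness

theorem difference_estimate {uh : Fin 2 → L2} {f b₀₁ ω₀₁ b₀₂ ω₀₂ : L2} {b₁ ω₁ b₂ ω₂ : ℝ → L2}
    {T : ℝ} (huh : MemSobolevDiv 3 uh) (hf : MemSobolev 2 f)
    (hb₀₁ : MemSobolev 3 b₀₁) (hω₀₁ : MemSobolev 2 ω₀₁)
    (hb₀₂ : MemSobolev 3 b₀₂) (hω₀₂ : MemSobolev 2 ω₀₂)
    (h₁ : IsStrongSolution uh f b₀₁ ω₀₁ b₁ ω₁ T) (h₂ : IsStrongSolution uh f b₀₂ ω₀₂ b₂ ω₂ T)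
    {B₁ W₁ W₂ : ℝ} (hB : ∀ t ∈ Set.Icc 0 T, sobolevNorm 3 (b₁ t) ≤ B₁ ∧
      sobolevNorm 2 (ω₁ t) ≤ W₁ ∧ sobolevNorm 2 (ω₂ t) ≤ W₂) {t : ℝ} (ht : t ∈ Set.Icc 0 T) :
    sobolevNorm 2 (b₁ t - b₂ t) ^ 2 + sobolevNorm 1 (ω₁ t - ω₂ t) ^ 2 ≤
      Real.exp (2 * (diffRate B₁ W₁ W₂ (sobolevNormVec 3 uh) (sobolevNorm 2 f)).toReal * T) *
        (sobolevNorm 2 (b₀₁ - b₀₂) ^ 2 + sobolevNorm 1 (ω₀₁ - ω₀₂) ^ 2) := by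
  obtain ⟨u₁, Db₁, Dω₁, s₁⟩ := h₁.exists_isFrequencySolution
  obtain ⟨u₂, Db₂, Dω₂, s₂⟩ := h₂.exists_isFrequencySolution
  set K := diffRate B₁ W₁ W₂ (sobolevNormVec 3 uh) (sobolevNorm 2 f) with hKdef
  have hK : K ≠ ⊤ := diffRate_ne_top _ _ _ _ _
  have he := embConst_ne_top
  set S : ℝ≥0∞ := ENNReal.ofReal (B₁ ^ 2) + ENNReal.ofReal (W₁ ^ 2) + ENNReal.ofReal (W₂ ^ 2) +
    ENNReal.ofReal (sobolevNormVec 3 uh ^ 2) + ENNReal.ofReal (sobolevNorm 2 f ^ 2) with hS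
  have hStop : S ≠ ⊤ := by finiteness
  have hKS : K = 2 + 1000000 * embConst * S := rfl
  have hcb := h₁.continuous_b.sub h₂.continuous_b
  have hcω := h₁.continuous_ω.sub h₂.continuous_ω
  obtain ⟨M₁, hM₁, hM₁'⟩ := hcb.exists_sobSq_le
  obtain ⟨M₂, hM₂, hM₂'⟩ := hcω.exists_sobSq_le
  set E : ℝ → ℝ := fun τ => sobolevNorm 2 (b₁ τ - b₂ τ) ^ 2 + sobolevNorm 1 (ω₁ τ - ω₂ τ) ^ 2
    with hEdef
  have hE0 : ∀ τ, 0 ≤ E τ := fun τ => by positivity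
  have hEc : ContinuousOn E (Set.Icc 0 T) :=
    ((hcb.mono (by norm_num : 2 ≤ 3) le_rfl).continuousOn.pow 2).add
      ((hcω.mono (by norm_num : 1 ≤ 2) le_rfl).continuousOn.pow 2)
  have hmb : ∀ τ ∈ Set.Icc 0 T, MemSobolev 2 (b₁ τ - b₂ τ) := fun τ hτ =>
    (hcb.1 τ hτ).mono (by norm_num)
  have hmω : ∀ τ ∈ Set.Icc 0 T, MemSobolev 1 (ω₁ τ - ω₂ τ) := fun τ hτ =>
    (hcω.1 τ hτ).mono (by norm_num)
  set G : ℝ → ℝ := fun τ => K.toReal * E τ with hGdef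
  have hGc : ContinuousOn G (Set.Icc 0 T) := continuousOn_const.mul hEc
  have hG0 : ∀ τ ∈ Set.Icc 0 T, 0 ≤ G τ := fun τ _ => mul_nonneg ENNReal.toReal_nonneg (hE0 τ)
  have hGe : ∀ τ ∈ Set.Icc 0 T, ENNReal.ofReal (G τ) =
      K * (sobSq 2 (b₁ τ - b₂ τ) + sobSq 1 (ω₁ τ - ω₂ τ)) := fun τ hτ => by
    rw [hGdef, ENNReal.ofReal_mul ENNReal.toReal_nonneg, ENNReal.ofReal_toReal hK,
      ENNReal.ofReal_add (sq_nonneg _) (sq_nonneg _), sobolevNorm_sq (hmb τ hτ),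
      sobolevNorm_sq (hmω τ hτ)]
  have hu₁ : ∀ τ ∈ Set.Icc 0 T, IsSolenoidal (vecCoeff (u₁ τ)) := fun τ hτ =>
    (s₁.velocity τ hτ).isSolenoidal
  have hu₂ : ∀ τ ∈ Set.Icc 0 T, IsSolenoidal (vecCoeff (u₂ τ)) := fun τ hτ =>
    (s₂.velocity τ hτ).isSolenoidal
  have huS : ∀ τ ∈ Set.Icc 0 T, sob 3 (modulus (vecCoeff (u₂ τ))) ≤ 8 * S := fun τ hτ => by
    refine (s₂.velocity τ hτ).sob_modulus_le.trans ?_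
    gcongr
    calc sobSq 2 (ω₂ τ) + sobSq 2 f ≤ ENNReal.ofReal (W₂ ^ 2) +
          ENNReal.ofReal (sobolevNorm 2 f ^ 2) :=
          add_le_add (sobSq_le_ofReal (h₂.continuous_ω.1 τ hτ) (hB τ hτ).2.2)
            (sobolevNorm_sq hf).ge
      _ ≤ ENNReal.ofReal (W₂ ^ 2) + ENNReal.ofReal (sobolevNorm 2 f ^ 2) +
          (ENNReal.ofReal (B₁ ^ 2) + ENNReal.ofReal (W₁ ^ 2) +
            ENNReal.ofReal (sobolevNormVec 3 uh ^ 2)) := le_self_add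
      _ = S := by rw [hS]; ring
  have hu2S : ∀ τ ∈ Set.Icc 0 T, sob 2 (modulus (vecCoeff (u₂ τ))) ≤ 8 * S := fun τ hτ =>
    (sob_mono (by norm_num) _).trans (huS τ hτ)
  have hδu : ∀ τ ∈ Set.Icc 0 T,
      sob 2 (modulus (vecCoeff (u₁ τ - u₂ τ))) ≤ 4 * sobSq 1 (ω₁ τ - ω₂ τ) := fun τ hτ =>
    ((s₁.velocity τ hτ).isBiotSavart_sub (s₂.velocity τ hτ)).sob_modulus_le 1
  have hbS : ∀ τ ∈ Set.Icc 0 T, sobSq 3 (b₁ τ) ≤ S := fun τ hτ =>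
    (sobSq_le_ofReal (h₁.continuous_b.1 τ hτ) (hB τ hτ).1).trans (by
      rw [hS]
      simp only [add_assoc]
      exact le_self_add)
  have hωS : ∀ τ ∈ Set.Icc 0 T, sobSq 2 (ω₁ τ) ≤ S := fun τ hτ =>
    (sobSq_le_ofReal (h₁.continuous_ω.1 τ hτ) (hB τ hτ).2.1).trans (by
      rw [hS]
      simp only [add_assoc]
      exact le_add_left le_self_add)
  have huhS : sob 2 (modulus (vecCoeff uh)) ≤ 2 * S := by
    refine (sob_mono (by norm_num : 2 ≤ 3) _).trans ((sob_modulus_vecCoeff_le huh.1).trans ?_)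
    gcongr
    rw [hS]
    exact le_add_right le_add_self
  have hqS : ∀ τ ∈ Set.Icc 0 T, sobSq 2 (ω₁ τ - b₁ τ) ≤ 4 * S := fun τ hτ => by
    calc sobSq 2 (ω₁ τ - b₁ τ) ≤ 2 * (sobSq 2 (ω₁ τ) + sobSq 2 (b₁ τ)) := sobSq_sub_le _ _ _
      _ ≤ 2 * (S + S) := by
        gcongr
        · exact hωS τ hτ
        · exact (sobSq_mono (by norm_num) _).trans (hbS τ hτ)
      _ = _ := by ring
  -- Everything except transport of the differences by `u₂` counts as forcing.
  set Rb : ℝ → Freq → ℂ := fun τ ξ => divCoeff (u₁ τ - u₂ τ) (b₁ τ) ξ with hRb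
  set Rω : ℝ → Freq → ℂ := fun τ ξ => divCoeff (u₁ τ - u₂ τ) (ω₁ τ - b₁ τ) ξ +
    (divCoeff uh (b₁ τ - b₂ τ) ξ + -divCoeff (u₂ τ) (b₁ τ - b₂ τ) ξ) with hRω
  have hRb' : ∀ τ ∈ Set.Icc 0 T, sob 2 (fun ξ => ‖Rb τ ξ‖ₑ) ≤
      3136 * (embConst * S) * sobSq 1 (ω₁ τ - ω₂ τ) := fun τ hτ => by
    refine (sob_divCoeff_le (k := 1) le_rfl ((hu₁ τ hτ).sub (hu₂ τ hτ)) (b₁ τ)).trans ?_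
    calc _ ≤ 784 * embConst * (4 * sobSq 1 (ω₁ τ - ω₂ τ)) * S := by
          gcongr
          · exact hδu τ hτ
          · exact hbS τ hτ
      _ = _ := by ring
  have hRω' : ∀ τ ∈ Set.Icc 0 T, sob 1 (fun ξ => ‖Rω τ ξ‖ₑ) ≤
      31360 * (embConst * S) * (sobSq 2 (b₁ τ - b₂ τ) + sobSq 1 (ω₁ τ - ω₂ τ)) := fun τ hτ => by
    have i1 := sob_divCoeff_le (k := 0) zero_le_one ((hu₁ τ hτ).sub (hu₂ τ hτ)) (ω₁ τ - b₁ τ)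
    have i2 := sob_divCoeff_le (k := 0) zero_le_one huh.isSolenoidal (b₁ τ - b₂ τ)
    have i3 := sob_divCoeff_le (k := 0) zero_le_one (hu₂ τ hτ) (b₁ τ - b₂ τ)
    have i4 := sob_add_le 1 (fun ξ => divCoeff uh (b₁ τ - b₂ τ) ξ)
      (fun ξ => -divCoeff (u₂ τ) (b₁ τ - b₂ τ) ξ)
    simp only [enorm_neg, zero_add] at i1 i2 i3 i4
    calc sob 1 (fun ξ => ‖Rω τ ξ‖ₑ)
        ≤ 2 * (784 * embConst * sob 2 (modulus (vecCoeff (u₁ τ - u₂ τ))) *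
            sobSq 2 (ω₁ τ - b₁ τ) + 2 * (784 * embConst * sob 2 (modulus (vecCoeff uh)) *
            sobSq 2 (b₁ τ - b₂ τ) + 784 * embConst * sob 2 (modulus (vecCoeff (u₂ τ))) *
            sobSq 2 (b₁ τ - b₂ τ))) := by
          refine (sob_add_le 1 _ _).trans (mul_le_mul_right (add_le_add i1 ?_) _)
          exact i4.trans (mul_le_mul_right (add_le_add i2 i3) _)
      _ ≤ 2 * (784 * embConst * (4 * sobSq 1 (ω₁ τ - ω₂ τ)) * (4 * S) +
            2 * (784 * embConst * (2 * S) * sobSq 2 (b₁ τ - b₂ τ) +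
              784 * embConst * (8 * S) * sobSq 2 (b₁ τ - b₂ τ))) := by
          gcongr
          · exact hδu τ hτ
          · exact hqS τ hτ
          · exact hu2S τ hτ
      -- In `[0,∞]` the domination is shown by adding the missing nonnegative terms and closing with
      -- an identity; here `6272 = 31360 - 2·784·16`. The same device recurs with longer remainders.
      _ ≤ 2 * (784 * embConst * (4 * sobSq 1 (ω₁ τ - ω₂ τ)) * (4 * S) +
            2 * (784 * embConst * (2 * S) * sobSq 2 (b₁ τ - b₂ τ) +
              784 * embConst * (8 * S) * sobSq 2 (b₁ τ - b₂ τ))) +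
            6272 * (embConst * S) * sobSq 1 (ω₁ τ - ω₂ τ) := le_self_add
      _ = _ := by ring
  have hX : ∀ τ ∈ Set.Icc 0 T, sobSq 2 (b₁ τ - b₂ τ) ≤ M₁ := fun τ hτ =>
    (sobSq_mono (by norm_num) _).trans (hM₁' τ hτ)
  have hY : ∀ τ ∈ Set.Icc 0 T, sobSq 1 (ω₁ τ - ω₂ τ) ≤ M₂ := fun τ hτ =>
    (sobSq_mono (by norm_num) _).trans (hM₂' τ hτ)
  set M : ℝ≥0∞ := M₁ + M₂ + 8 * S + 31360 * (embConst * S) * (M₁ + M₂) with hM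
  have hMtop : M ≠ ⊤ := by finiteness
  have hRbM : ∀ τ ∈ Set.Icc 0 T, sob 2 (fun ξ => ‖Rb τ ξ‖ₑ) ≤ M := fun τ hτ => by
    refine (hRb' τ hτ).trans (le_trans ?_ le_add_self)
    gcongr
    · norm_num
    · exact (hY τ hτ).trans le_add_self
  have hRωM : ∀ τ ∈ Set.Icc 0 T, sob 1 (fun ξ => ‖Rω τ ξ‖ₑ) ≤ M := fun τ hτ => by
    refine (hRω' τ hτ).trans (le_trans ?_ le_add_self)
    gcongr
    · exact hX τ hτ
    · exact hY τ hτ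
  have h8M : 8 * S ≤ M := by
    rw [hM]
    exact le_add_right le_add_self
  have hM1M : M₁ ≤ M := by
    rw [hM]
    simp only [add_assoc]
    exact le_self_add
  have hM2M : M₂ ≤ M := by
    rw [hM]
    simp only [add_assoc]
    exact le_add_left le_self_add
  have hvb : ∀ τ ∈ Set.Icc 0 T, b₁ τ - b₂ τ =
      (b₀₁ - b₀₂) - ∫ s in (0 : ℝ)..τ, (Db₁ s - Db₂ s) := fun τ hτ => by
    have hsub : Set.uIcc 0 τ ⊆ Set.uIcc 0 T := by
      rw [Set.uIcc_of_le hτ.1, Set.uIcc_of_le h₁.pos.le]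
      exact Set.Icc_subset_Icc le_rfl hτ.2
    rw [intervalIntegral.integral_sub (s₁.integrable_Db.mono_set hsub)
      (s₂.integrable_Db.mono_set hsub), s₁.eq_b τ hτ, s₂.eq_b τ hτ]
    abel
  have hvω : ∀ τ ∈ Set.Icc 0 T, ω₁ τ - ω₂ τ =
      (ω₀₁ - ω₀₂) - ∫ s in (0 : ℝ)..τ, (Dω₁ s - Dω₂ s) := fun τ hτ => by
    have hsub : Set.uIcc 0 τ ⊆ Set.uIcc 0 T := by
      rw [Set.uIcc_of_le hτ.1, Set.uIcc_of_le h₁.pos.le]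
      exact Set.Icc_subset_Icc le_rfl hτ.2
    rw [intervalIntegral.integral_sub (s₁.integrable_Dω.mono_set hsub)
      (s₂.integrable_Dω.mono_set hsub), s₁.eq_ω τ hτ, s₂.eq_ω τ hτ]
    abel
  have hI0 : ∀ s ∈ Set.Icc 0 T, 0 ≤ ∫ τ in (0 : ℝ)..s, G τ := fun s hs =>
    intervalIntegral.integral_nonneg hs.1 fun τ hτ => hG0 τ ⟨hτ.1, hτ.2.trans hs.2⟩
  have eb : ∀ s ∈ Set.Icc 0 T, sobolevNorm 2 (b₁ s - b₂ s) ^ 2 ≤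
      sobolevNorm 2 (b₀₁ - b₀₂) ^ 2 + ∫ τ in (0 : ℝ)..s, G τ := fun s hs => by
    refine sobolevNorm_sq_le_add (hmb s hs) ((hb₀₁.sub hb₀₂).mono (by norm_num)) (hI0 s hs) ?_
    have := isWeight_lam_sq.energy_le le_rfl (s₁.integrable_Db.sub s₂.integrable_Db) hvb
      (U := u₂) (R := Rb) hu₂ (fun τ hτ ξ => ?_) hMtop (fun τ hτ => (hM₁' τ hτ).trans hM1M)
      (fun τ hτ => (hu2S τ hτ).trans h8M) hRbM hGc hG0 (fun τ hτ => ?_) hs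
    · rwa [sqSum_lam_pow 2] at this
    · rw [fourierCoeff_sub, s₁.coeff_Db τ hτ, s₂.coeff_Db τ hτ,
        divCoeff_sub (hu₁ τ hτ) (hu₂ τ hτ)]
    · rw [hGe τ hτ, hKS]
      refine (add_le_add (mul_le_mul_left (add_le_add_right (mul_le_mul_right (huS τ hτ) _) _) _)
        (hRb' τ hτ)).trans ?_
      generalize sobSq 2 (b₁ τ - b₂ τ) = X
      generalize sobSq 1 (ω₁ τ - ω₂ τ) = Y
      refine le_trans (le_self_add
        (b := 2 * Y + 843200 * (embConst * S) * X + 996864 * (embConst * S) * Y)) (le_of_eq ?_)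
      ring
  have eω : ∀ s ∈ Set.Icc 0 T, sobolevNorm 1 (ω₁ s - ω₂ s) ^ 2 ≤
      sobolevNorm 1 (ω₀₁ - ω₀₂) ^ 2 + ∫ τ in (0 : ℝ)..s, G τ := fun s hs => by
    refine sobolevNorm_sq_le_add (hmω s hs) ((hω₀₁.sub hω₀₂).mono (by norm_num)) (hI0 s hs) ?_
    have := isWeight_lam.energy_le zero_le_one (s₁.integrable_Dω.sub s₂.integrable_Dω) hvω
      (U := u₂) (R := Rω) hu₂ (fun τ hτ ξ => ?_) hMtop (fun τ hτ => (hM₂' τ hτ).trans hM2M)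
      (fun τ hτ => (hu2S τ hτ).trans h8M) hRωM hGc hG0 (fun τ hτ => ?_) hs
    · have e := sqSum_lam_pow 1 (ω₁ s - ω₂ s)
      simp only [pow_one] at e
      rwa [e] at this
    · have hq : (ω₁ τ - b₁ τ) - (ω₂ τ - b₂ τ) = (ω₁ τ - ω₂ τ) - (b₁ τ - b₂ τ) := by abel
      have d1 := divCoeff_sub (hu₁ τ hτ) (hu₂ τ hτ) (ω₁ τ - b₁ τ) (ω₂ τ - b₂ τ) ξ
      rw [hq, divCoeff_sub_right (hu₂ τ hτ) (ω₁ τ - ω₂ τ)] at d1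
      have d2 := divCoeff_sub_right huh.isSolenoidal (b₁ τ) (b₂ τ) ξ
      rw [fourierCoeff_sub, s₁.coeff_Dω τ hτ, s₂.coeff_Dω τ hτ]
      simp only [hRω]
      linear_combination d1 - d2
    · rw [hGe τ hτ, hKS]
      refine (add_le_add (mul_le_mul_left (add_le_add_right (mul_le_mul_right (huS τ hτ) _) _) _)
        (hRω' τ hτ)).trans ?_
      generalize sobSq 2 (b₁ τ - b₂ τ) = X
      generalize sobSq 1 (ω₁ τ - ω₂ τ) = Y
      refine le_trans (le_self_add
        (b := 2 * X + 968640 * (embConst * S) * X + 811840 * (embConst * S) * Y)) (le_of_eq ?_)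
      ring
  -- The rate is doubled because the inequalities for `b` and for `ω` each carry the full integral
  -- of `G`.
  have hfinal := le_mul_exp_of_le_add_integral (K := 2 * K.toReal)
    (y₀ := sobolevNorm 2 (b₀₁ - b₀₂) ^ 2 + sobolevNorm 1 (ω₀₁ - ω₀₂) ^ 2)
    (mul_nonneg zero_le_two ENNReal.toReal_nonneg) hEc (fun s hs => by
      have e : ∫ τ in (0 : ℝ)..s, 2 * K.toReal * E τ = 2 * ∫ τ in (0 : ℝ)..s, G τ := by
        rw [← intervalIntegral.integral_const_mul]
        simp only [hGdef, mul_assoc]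
      rw [e]
      have := eb s hs
      have := eω s hs
      simp only [hEdef]
      linarith) t ht
  refine hfinal.trans ?_
  rw [mul_comm]
  gcongr
  exact ht.2

/-! ### A priori bounds on the local existence time scale -/

/-- The growth rate in the a priori estimate. -/
def growthRate (U F : ℝ) : ℝ≥0∞ :=
  2 + 1000000 * embConst * (1 + ENNReal.ofReal (U ^ 2) + ENNReal.ofReal (F ^ 2))

theorem growthRate_ne_top (U F : ℝ) : growthRate U F ≠ ⊤ := by
  have := embConst_ne_top
  unfold growthRate
  finiteness

theorem growthRate_toReal_pos (U F : ℝ) : 0 < (growthRate U F).toReal :=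
  ENNReal.toReal_pos (by simp [growthRate]) (growthRate_ne_top U F)

/-- On a finite set of frequencies the cutoff is inactive once `N` is at least the sum of the
weights there. -/
theorem sobSq_le_of_forall_truncation {k : ℕ} {v : L2} {A : ℝ≥0∞}
    (h : ∀ N : ℝ, 0 ≤ N →
      sqSum (fun ξ => ‖lam ξ ^ k * min (lam ξ) N‖ₑ * ‖fourierCoeff v ξ‖ₑ) ≤ A) :
    sobSq (k + 1) v ≤ A := by
  rw [sobSq, sob, sqSum, ENNReal.tsum_eq_iSup_sum]
  refine iSup_le fun s => ?_
  refine le_trans ?_ ((ENNReal.sum_le_tsum s).trans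
    (h (∑ ξ ∈ s, lam ξ) (Finset.sum_nonneg fun ξ _ => (lam_pos ξ).le)))
  refine Finset.sum_le_sum fun ξ hξ => ?_
  have hle : lam ξ ≤ ∑ ξ ∈ s, lam ξ :=
    Finset.single_le_sum (f := lam) (fun ξ _ => (lam_pos ξ).le) hξ
  beta_reduce
  rw [min_eq_left hle, ← pow_succ, enorm_pow, elam, ← ofReal_norm (lam ξ),
    Real.norm_of_nonneg (lam_pos ξ).le]

theorem apriori_bound {uh : Fin 2 → L2} {f b₀ ω₀ : L2} {b ω : ℝ → L2} {T : ℝ}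
    (huh : MemSobolevDiv 3 uh) (hf : MemSobolev 2 f)
    (hb₀ : MemSobolev 3 b₀) (hω₀ : MemSobolev 2 ω₀) (h : IsStrongSolution uh f b₀ ω₀ b ω T)
    (hT : T < 1 / (2 * (4 * (growthRate (sobolevNormVec 3 uh) (sobolevNorm 2 f)).toReal) *
      (1 + strongNorm b₀ ω₀ ^ 2))) {t : ℝ} (ht : t ∈ Set.Icc 0 T) :
    sobolevNorm 3 (b t) ^ 2 + sobolevNorm 2 (ω t) ^ 2 ≤ 2 * (1 + strongNorm b₀ ω₀ ^ 2) := by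
  obtain ⟨u, Db, Dω, s⟩ := h.exists_isFrequencySolution
  set K := growthRate (sobolevNormVec 3 uh) (sobolevNorm 2 f) with hKdef
  have hK : K ≠ ⊤ := growthRate_ne_top _ _
  have hKpos : 0 < K.toReal := growthRate_toReal_pos _ _
  have he := embConst_ne_top
  set Us : ℝ≥0∞ := ENNReal.ofReal (sobolevNormVec 3 uh ^ 2) with hUs
  set Fs : ℝ≥0∞ := ENNReal.ofReal (sobolevNorm 2 f ^ 2) with hFs
  have hUtop : Us ≠ ⊤ := ENNReal.ofReal_ne_top
  have hFtop : Fs ≠ ⊤ := ENNReal.ofReal_ne_top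
  have hKS : K = 2 + 1000000 * embConst * (1 + Us + Fs) := rfl
  obtain ⟨M₁, hM₁, hM₁'⟩ := h.continuous_b.exists_sobSq_le
  obtain ⟨M₂, hM₂, hM₂'⟩ := h.continuous_ω.exists_sobSq_le
  -- The summand 1 lets constant and linear terms be absorbed into `y²`, so the inequality closes.
  set y : ℝ → ℝ := fun τ => 1 + (sobolevNorm 3 (b τ) ^ 2 + sobolevNorm 2 (ω τ) ^ 2) with hy
  have hy0 : ∀ τ, 0 ≤ y τ := fun τ => by positivity
  have hyc : ContinuousOn y (Set.Icc 0 T) :=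
    continuousOn_const.add ((h.continuous_b.continuousOn.pow 2).add
      (h.continuous_ω.continuousOn.pow 2))
  set G : ℝ → ℝ := fun τ => K.toReal * y τ ^ 2 with hGdef
  have hGc : ContinuousOn G (Set.Icc 0 T) := continuousOn_const.mul (hyc.pow 2)
  have hG0 : ∀ τ ∈ Set.Icc 0 T, 0 ≤ G τ := fun τ _ => by positivity
  have hGe : ∀ τ ∈ Set.Icc 0 T, ENNReal.ofReal (G τ) =
      K * (1 + (sobSq 3 (b τ) + sobSq 2 (ω τ))) ^ 2 := fun τ hτ => by
    rw [hGdef, ENNReal.ofReal_mul ENNReal.toReal_nonneg, ENNReal.ofReal_toReal hK,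
      ENNReal.ofReal_pow (hy0 τ), hy, ENNReal.ofReal_add zero_le_one (by positivity),
      ENNReal.ofReal_add (sq_nonneg _) (sq_nonneg _), sobolevNorm_sq (h.continuous_b.1 τ hτ),
      sobolevNorm_sq (h.continuous_ω.1 τ hτ), ENNReal.ofReal_one]
  have hu : ∀ τ ∈ Set.Icc 0 T, IsSolenoidal (vecCoeff (u τ)) := fun τ hτ =>
    (s.velocity τ hτ).isSolenoidal
  have huS : ∀ τ ∈ Set.Icc 0 T,
      sob 3 (modulus (vecCoeff (u τ))) ≤ 8 * (sobSq 2 (ω τ) + Fs) := fun τ hτ => by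
    refine (s.velocity τ hτ).sob_modulus_le.trans_eq ?_
    rw [hFs, sobolevNorm_sq hf]
  have hu2S : ∀ τ ∈ Set.Icc 0 T,
      sob 2 (modulus (vecCoeff (u τ))) ≤ 8 * (sobSq 2 (ω τ) + Fs) := fun τ hτ =>
    (sob_mono (by norm_num) _).trans (huS τ hτ)
  have huhS : sob 2 (modulus (vecCoeff uh)) ≤ 2 * Us :=
    (sob_mono (by norm_num : 2 ≤ 3) _).trans (sob_modulus_vecCoeff_le huh.1)
  set Rω : ℝ → Freq → ℂ := fun τ ξ => divCoeff uh (b τ) ξ + -divCoeff (u τ) (b τ) ξ with hRω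
  have hRω' : ∀ τ ∈ Set.Icc 0 T, sob 2 (fun ξ => ‖Rω τ ξ‖ₑ) ≤
      12544 * embConst * (sobSq 2 (ω τ) + Us + Fs) * sobSq 3 (b τ) := fun τ hτ => by
    have i2 := sob_divCoeff_le (k := 1) le_rfl huh.isSolenoidal (b τ)
    have i3 := sob_divCoeff_le (k := 1) le_rfl (hu τ hτ) (b τ)
    have i4 := sob_add_le 2 (fun ξ => divCoeff uh (b τ) ξ) (fun ξ => -divCoeff (u τ) (b τ) ξ)
    simp only [enorm_neg, Nat.reduceAdd] at i2 i3 i4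
    calc sob 2 (fun ξ => ‖Rω τ ξ‖ₑ)
        ≤ 2 * (784 * embConst * sob 2 (modulus (vecCoeff uh)) * sobSq 3 (b τ) +
            784 * embConst * sob 2 (modulus (vecCoeff (u τ))) * sobSq 3 (b τ)) :=
          i4.trans (mul_le_mul_right (add_le_add i2 i3) _)
      _ ≤ 2 * (784 * embConst * (2 * Us) * sobSq 3 (b τ) +
            784 * embConst * (8 * (sobSq 2 (ω τ) + Fs)) * sobSq 3 (b τ)) := by
          gcongr
          exact hu2S τ hτ
      _ ≤ 2 * (784 * embConst * (2 * Us) * sobSq 3 (b τ) +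
            784 * embConst * (8 * (sobSq 2 (ω τ) + Fs)) * sobSq 3 (b τ)) +
            9408 * embConst * Us * sobSq 3 (b τ) := le_self_add
      _ = _ := by ring
  set M : ℝ≥0∞ := M₁ + M₂ + 8 * (M₂ + Fs) + 12544 * embConst * (M₂ + Us + Fs) * M₁ with hM
  have hMtop : M ≠ ⊤ := by finiteness
  have huM : ∀ τ ∈ Set.Icc 0 T, sob 2 (modulus (vecCoeff (u τ))) ≤ M := fun τ hτ => by
    refine (hu2S τ hτ).trans (le_trans ?_ (le_add_right le_add_self))
    gcongr
    exact hM₂' τ hτ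
  have hRωM : ∀ τ ∈ Set.Icc 0 T, sob 1 (fun ξ => ‖Rω τ ξ‖ₑ) ≤ M := fun τ hτ => by
    refine (sob_mono (by norm_num : 1 ≤ 2) _).trans ((hRω' τ hτ).trans (le_trans ?_ le_add_self))
    gcongr
    · exact hM₂' τ hτ
    · exact hM₁' τ hτ
  have hM1M : M₁ ≤ M := by
    rw [hM]
    simp only [add_assoc]
    exact le_self_add
  have hM2M : M₂ ≤ M := by
    rw [hM]
    simp only [add_assoc]
    exact le_add_left le_self_add
  have hI0 : ∀ r ∈ Set.Icc 0 T, 0 ≤ ∫ τ in (0 : ℝ)..r, G τ := fun r hr =>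
    intervalIntegral.integral_nonneg hr.1 fun τ hτ => hG0 τ ⟨hτ.1, hτ.2.trans hr.2⟩
  have eb : ∀ r ∈ Set.Icc 0 T, sobolevNorm 3 (b r) ^ 2 ≤
      sobolevNorm 3 b₀ ^ 2 + ∫ τ in (0 : ℝ)..r, G τ := fun r hr => by
    refine sobolevNorm_sq_le_add (h.continuous_b.1 r hr) hb₀ (hI0 r hr) ?_
    -- The untruncated weight `⟨ξ⟩³` would require `b` in `W^{4,2}` for absolute convergence; each
    -- truncated weight needs only `W^{3,2}`.
    refine sobSq_le_of_forall_truncation fun N hN => ?_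
    refine (isWeight_lam_sq_mul_min hN).energy_le le_rfl s.integrable_Db s.eq_b
      (U := u) (R := fun _ _ => 0) hu (fun τ hτ ξ => ?_) hMtop (fun τ hτ => (hM₁' τ hτ).trans hM1M)
      huM (fun τ hτ => by simp [sob, sqSum]) hGc hG0 (fun τ hτ => ?_) hr
    · rw [s.coeff_Db τ hτ, add_zero]
    · have hz : sob 3 (fun _ : Freq => ‖(0 : ℂ)‖ₑ) = 0 := by simp [sob, sqSum]
      rw [hGe τ hτ, hKS, hz, add_zero]
      refine (mul_le_mul_left (add_le_add_right (mul_le_mul_right (huS τ hτ) _) _) _).trans ?_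
      generalize sobSq 3 (b τ) = X
      generalize sobSq 2 (ω τ) = Y
      refine le_trans (le_self_add (b := 2 * (1 + X + 2 * Y + (X + Y) ^ 2) +
        1000000 * embConst * Us * (1 + (X + Y)) ^ 2 +
        embConst * (1000000 * (1 + X ^ 2 + Y ^ 2 + 2 * X + 2 * Y) + 1843200 * (X * Y)) +
        embConst * Fs * (1000000 * (1 + X ^ 2 + Y ^ 2 + 2 * (X * Y) + 2 * Y) +
          1843200 * X))) (le_of_eq ?_)
      ring
  have eω : ∀ r ∈ Set.Icc 0 T, sobolevNorm 2 (ω r) ^ 2 ≤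
      sobolevNorm 2 ω₀ ^ 2 + ∫ τ in (0 : ℝ)..r, G τ := fun r hr => by
    refine sobolevNorm_sq_le_add (h.continuous_ω.1 r hr) hω₀ (hI0 r hr) ?_
    refine sobSq_le_of_forall_truncation fun N hN => ?_
    simp only [pow_one]
    refine (isWeight_lam_mul_min hN).energy_le zero_le_one s.integrable_Dω s.eq_ω
      (U := u) (R := Rω) hu (fun τ hτ ξ => ?_) hMtop (fun τ hτ => (hM₂' τ hτ).trans hM2M)
      huM hRωM hGc hG0 (fun τ hτ => ?_) hr
    · rw [s.coeff_Dω τ hτ, divCoeff_sub_right (hu τ hτ)]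
      simp only [hRω]
      ring
    · rw [hGe τ hτ, hKS]
      refine (add_le_add (mul_le_mul_left (add_le_add_right (mul_le_mul_right (huS τ hτ) _) _) _)
        (hRω' τ hτ)).trans ?_
      generalize sobSq 3 (b τ) = X
      generalize sobSq 2 (ω τ) = Y
      refine le_trans (le_self_add (b := 2 * (1 + 2 * X + Y + (X + Y) ^ 2) +
        embConst * Us * (1000000 * (1 + X ^ 2 + Y ^ 2 + 2 * (X * Y) + 2 * Y) + 1987456 * X) +
        embConst * (1000000 * (1 + X ^ 2 + 2 * X + 2 * Y) + 843200 * Y ^ 2 + 1987456 * (X * Y)) +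
        embConst * Fs * (1000000 * (1 + X ^ 2 + Y ^ 2 + 2 * (X * Y)) + 1987456 * X +
          1843200 * Y))) (le_of_eq ?_)
      ring
  set m : ℝ := 1 + strongNorm b₀ ω₀ ^ 2 with hm
  have hm0 : 0 < m := by positivity
  have hdata : 1 + (sobolevNorm 3 b₀ ^ 2 + sobolevNorm 2 ω₀ ^ 2) ≤ m := by
    have := mul_nonneg (sobolevNorm_nonneg 3 b₀) (sobolevNorm_nonneg 2 ω₀)
    rw [hm, strongNorm]
    nlinarith
  -- With `C = 2K` and `y₀ = m`, the smallness condition is `8 K m T < 1`, which is `hT`; this is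
  -- the origin of the choice `κ = 4K`.
  have hfinal := le_two_mul_of_le_add_integral_sq (C := 2 * K.toReal) (y₀ := m) (by positivity) hm0
    (by
      rw [lt_div_iff₀ (by positivity)] at hT
      linarith) hyc (fun τ _ => hy0 τ) (fun r hr => by
      have e : ∫ τ in (0 : ℝ)..r, 2 * K.toReal * y τ ^ 2 = 2 * ∫ τ in (0 : ℝ)..r, G τ := by
        rw [← intervalIntegral.integral_const_mul]
        simp only [hGdef, mul_assoc]
      rw [e]
      have := eb r hr
      have := eω r hr
      simp only [hy]
      linarith) t ht
  simp only [hy] at hfinal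
  linarith

end TQG

end

/-! ### Choice of the constants and conclusion -/

theorem mainTheorem3 :
    -- on the local existence time scale, `c` depends only on the norms of the data
    (∃ κ : ℝ → ℝ → ℝ, (∀ p q, 0 < κ p q) ∧
      ∃ c : ℝ → ℝ → ℝ → ℝ → ℝ → ℝ → ℝ,
        ∀ (uh : Fin 2 → TQG.L2) (f b₀₁ ω₀₁ b₀₂ ω₀₂ : TQG.L2)
          (b₁ ω₁ b₂ ω₂ : ℝ → TQG.L2) (T₁ T₂ T : ℝ),
          TQG.MemSobolevDiv 3 uh → TQG.MemSobolev 2 f →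
          TQG.MemSobolev 3 b₀₁ → TQG.MemSobolev 2 ω₀₁ →
          TQG.MemSobolev 3 b₀₂ → TQG.MemSobolev 2 ω₀₂ →
          TQG.IsStrongSolution uh f b₀₁ ω₀₁ b₁ ω₁ T₁ →
          TQG.IsStrongSolution uh f b₀₂ ω₀₂ b₂ ω₂ T₂ →
          T = min T₁ T₂ →
          T < 1 / (2 * κ (TQG.sobolevNormVec 3 uh) (TQG.sobolevNorm 2 f) *
            (1 + TQG.strongNorm b₀₁ ω₀₁ ^ 2)) →
          T < 1 / (2 * κ (TQG.sobolevNormVec 3 uh) (TQG.sobolevNorm 2 f) *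
            (1 + TQG.strongNorm b₀₂ ω₀₂ ^ 2)) →
          ∀ t ∈ Set.Icc 0 T,
            TQG.sobolevNorm 2 (b₁ t - b₂ t) ^ 2 + TQG.sobolevNorm 1 (ω₁ t - ω₂ t) ^ 2 ≤
              Real.exp (c (TQG.sobolevNorm 3 b₀₁) (TQG.sobolevNorm 2 ω₀₁)
                  (TQG.sobolevNorm 3 b₀₂) (TQG.sobolevNorm 2 ω₀₂)
                  (TQG.sobolevNormVec 3 uh) (TQG.sobolevNorm 2 f) * T) *
                (TQG.sobolevNorm 2 (b₀₁ - b₀₂) ^ 2 + TQG.sobolevNorm 1 (ω₀₁ - ω₀₂) ^ 2)) ∧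
    -- for arbitrary existence times, `c` depends on bounds for the strong norms of the
    -- solutions on `[0,T]`
    (∃ c : ℝ → ℝ → ℝ → ℝ → ℝ → ℝ,
      ∀ (uh : Fin 2 → TQG.L2) (f b₀₁ ω₀₁ b₀₂ ω₀₂ : TQG.L2)
        (b₁ ω₁ b₂ ω₂ : ℝ → TQG.L2) (T₁ T₂ T : ℝ),
        TQG.MemSobolevDiv 3 uh → TQG.MemSobolev 2 f →
        TQG.MemSobolev 3 b₀₁ → TQG.MemSobolev 2 ω₀₁ →
        TQG.MemSobolev 3 b₀₂ → TQG.MemSobolev 2 ω₀₂ →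
        TQG.IsStrongSolution uh f b₀₁ ω₀₁ b₁ ω₁ T₁ →
        TQG.IsStrongSolution uh f b₀₂ ω₀₂ b₂ ω₂ T₂ →
        T = min T₁ T₂ →
        ∀ B₁ W₁ W₂ : ℝ,
          (∀ t ∈ Set.Icc 0 T, TQG.sobolevNorm 3 (b₁ t) ≤ B₁ ∧
            TQG.sobolevNorm 2 (ω₁ t) ≤ W₁ ∧ TQG.sobolevNorm 2 (ω₂ t) ≤ W₂) →
          ∀ t ∈ Set.Icc 0 T,
            TQG.sobolevNorm 2 (b₁ t - b₂ t) ^ 2 + TQG.sobolevNorm 1 (ω₁ t - ω₂ t) ^ 2 ≤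
              Real.exp (c B₁ W₁ W₂ (TQG.sobolevNormVec 3 uh) (TQG.sobolevNorm 2 f) * T) *
                (TQG.sobolevNorm 2 (b₀₁ - b₀₂) ^ 2 + TQG.sobolevNorm 1 (ω₀₁ - ω₀₂) ^ 2)) := by
  refine ⟨⟨fun p q => 4 * (TQG.growthRate p q).toReal,
    fun p q => mul_pos four_pos (TQG.growthRate_toReal_pos p q),
    -- The square roots are the bounds that `apriori_bound` gives for the individual norms,
    -- expressed through the data.
    fun β₁ ϖ₁ β₂ ϖ₂ p q => 2 * (TQG.diffRate (Real.sqrt (2 * (1 + (β₁ + ϖ₁) ^ 2)))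
      (Real.sqrt (2 * (1 + (β₁ + ϖ₁) ^ 2))) (Real.sqrt (2 * (1 + (β₂ + ϖ₂) ^ 2))) p q).toReal, ?_⟩,
    ⟨fun B₁ W₁ W₂ p q => 2 * (TQG.diffRate B₁ W₁ W₂ p q).toReal, ?_⟩⟩
  · intro uh f b₀₁ ω₀₁ b₀₂ ω₀₂ b₁ ω₁ b₂ ω₂ T₁ T₂ T huh hf hb₀₁ hω₀₁ hb₀₂ hω₀₂ h₁ h₂ hT hT₁ hT₂ t ht
    have hpos : 0 < T := hT ▸ lt_min h₁.pos h₂.pos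
    have h₁' := h₁.mono hpos (hT ▸ min_le_left _ _)
    have h₂' := h₂.mono hpos (hT ▸ min_le_right _ _)
    refine TQG.difference_estimate huh hf hb₀₁ hω₀₁ hb₀₂ hω₀₂ h₁' h₂' (fun s hs => ?_) ht
    have a₁ := TQG.apriori_bound huh hf hb₀₁ hω₀₁ h₁' hT₁ hs
    have a₂ := TQG.apriori_bound huh hf hb₀₂ hω₀₂ h₂' hT₂ hs
    rw [TQG.strongNorm] at a₁ a₂
    refine ⟨Real.le_sqrt_of_sq_le ?_, Real.le_sqrt_of_sq_le ?_, Real.le_sqrt_of_sq_le ?_⟩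
    · exact le_trans (le_add_of_nonneg_right (sq_nonneg _)) a₁
    · exact le_trans (le_add_of_nonneg_left (sq_nonneg _)) a₁
    · exact le_trans (le_add_of_nonneg_left (sq_nonneg _)) a₂
  · intro uh f b₀₁ ω₀₁ b₀₂ ω₀₂ b₁ ω₁ b₂ ω₂ T₁ T₂ T huh hf hb₀₁ hω₀₁ hb₀₂ hω₀₂ h₁ h₂ hT B₁ W₁ W₂ hB
      t ht
    have hpos : 0 < T := hT ▸ lt_min h₁.pos h₂.pos
    exact TQG.difference_estimate huh hf hb₀₁ hω₀₁ hb₀₂ hω₀₂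
      (h₁.mono hpos (hT ▸ min_le_left _ _)) (h₂.mono hpos (hT ▸ min_le_right _ _)) hB ht
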